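/- Let $n,m\ge 2$ be integers and let $q\in\mathbb C$ with $|q|=1$. Let $\mathcal E^q_{n,m}$ be the universal unital $C^*$-algebra generated by elements $s_1,\dots,s_n$ and $t_1,\dots,t_m$ subject to the relations \[ s_i^*s_j=\delta_{ij}\mathbf 1,\qquad t_r^*t_l=\delta_{rl}\mathbf 1,\qquad s_j^*t_r=q\,t_rs_j^* \qquad(1\le i,j\le n,\ 1\le r,l\le m). \] Put $Q=\sum_{j=1}^n s_js_j^*$ and $P=\sum_{r=1}^m t_rt_r^*$, and let $\mathcal M_q$ be the closed two-sided ideal of $\mathcal E^q_{n,m}$ generated by $\mathbf 1-P$ and $\mathbf 1-Q$. Then $\mathcal M_q$ is the unique largest ideal of $\mathcal E^q_{n,m}$: it is a proper closed two-sided ideal, it contains every proper closed two-sided ideal of $\mathcal E^q_{n,m}$, and it is the only maximal element among the proper closed two-sided ideals. -/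

import Mathlib

open scoped ENNReal

noncomputable section

universe u v

/-! ### The defining relations -/

/-- The defining relations of `𝓔^q_{n,m}` for elements `s₁, …, sₙ`, `t₁, …, tₘ` of a unital
C⋆-algebra: `sᵢ* sⱼ = δᵢⱼ 1`, `tᵣ* tₗ = δᵣₗ 1` and `sⱼ* tᵣ = q tᵣ sⱼ*`. -/
structure IsQFamily (q : ℂ) {n m : ℕ} {A : Type u} [CStarAlgebra A]
    (s : Fin n → A) (t : Fin m → A) : Prop where
  star_s_mul_s : ∀ i j, star (s i) * s j = if i = j then 1 else 0
  star_t_mul_t : ∀ r l, star (t r) * t l = if r = l then 1 else 0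
  star_s_mul_t : ∀ j r, star (s j) * t r = q • (t r * star (s j))

/-! ### A copy in `Type` of a C⋆-algebra that is generated by few elements -/

namespace QTensor

/-- The closed unital *-subalgebra generated by a family of elements. -/
def generated {A : Type u} [CStarAlgebra A] {X : Type v} (g : X → A) : StarSubalgebra ℂ A :=
  (StarAlgebra.adjoin ℂ (Set.range g)).topologicalClosure

lemma isClosed_generated {A : Type u} [CStarAlgebra A] {X : Type v} (g : X → A) :
    IsClosed (generated g : Set A) :=
  StarSubalgebra.isClosed_topologicalClosure _

instance instCStarAlgebraGenerated {A : Type u} [CStarAlgebra A] {X : Type v} (g : X → A) :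
    CStarAlgebra (generated g) :=
  haveI : IsClosed (generated g : Set A) := isClosed_generated g
  StarSubalgebra.cstarAlgebra (generated g)

lemma mem_generated {A : Type u} [CStarAlgebra A] {X : Type v} (g : X → A) (x : X) :
    g x ∈ generated g :=
  StarSubalgebra.le_topologicalClosure _ (StarAlgebra.subset_adjoin ℂ _ ⟨x, rfl⟩)

/-- A C⋆-algebra generated by a family indexed by a type in `Type` has a copy in `Type`. -/
instance small_generated {A : Type u} [CStarAlgebra A] {X : Type} (g : X → A) :
    Small.{0} (generated g) := by
  have hadj : Small.{0} (StarAlgebra.adjoin ℂ (Set.range g) : Set A) := by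
    have h1 : (StarAlgebra.adjoin ℂ (Set.range g) : Set A) =
        Set.range (FreeAlgebra.lift ℂ (Sum.elim g (fun x => star (g x)))) := by
      have h2 : (StarAlgebra.adjoin ℂ (Set.range g)).toSubalgebra =
          (FreeAlgebra.lift ℂ (Sum.elim g (fun x => star (g x)))).range := by
        rw [StarAlgebra.adjoin_toSubalgebra, ← Algebra.adjoin_range_eq_range_freeAlgebra_lift,
          Set.Sum.elim_range]
        congr 2
        ext y
        constructor
        · rintro ⟨x, hx⟩
          exact ⟨x, by simp [hx]⟩
        · rintro ⟨x, rfl⟩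
          exact ⟨x, by simp⟩
      ext y
      exact SetLike.ext_iff.1 h2 y
    rw [h1]
    infer_instance
  have hseq : Function.Surjective (fun f : {f : ℕ → (StarAlgebra.adjoin ℂ (Set.range g) : Set A) //
      ∃ a : A, Filter.Tendsto (fun k => (f k : A)) Filter.atTop (nhds a)} =>
      (⟨f.2.choose, mem_closure_of_tendsto f.2.choose_spec
        (Filter.Eventually.of_forall fun k => (f.1 k).2)⟩ : generated g)) := by
    rintro ⟨a, ha⟩
    obtain ⟨f, hf, hfa⟩ := mem_closure_iff_seq_limit.1 ha
    refine ⟨⟨fun k => ⟨f k, hf k⟩, a, hfa⟩, Subtype.ext ?_⟩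
    exact tendsto_nhds_unique (Exists.choose_spec (p := fun b : A =>
      Filter.Tendsto (fun k => f k) Filter.atTop (nhds b)) ⟨a, hfa⟩) hfa
  exact small_of_surjective hseq

/-- A copy in `Type` of a C⋆-algebra of small cardinality. -/
def SmallCopy (A : Type u) [Small.{0} A] : Type := Shrink.{0} A

section SmallCopy

variable (A : Type u) [Small.{0} A]

/-- The bijection between the copy and the original. -/
def smallCopyEquiv : SmallCopy A ≃ A := (equivShrink A).symm

variable [CStarAlgebra A]

instance instNormedRingSmallCopy : NormedRing (SmallCopy A) := (smallCopyEquiv A).normedRing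

instance instAlgebraSmallCopy : Algebra ℂ (SmallCopy A) := (smallCopyEquiv A).algebra ℂ

instance instStarSmallCopy : Star (SmallCopy A) :=
  ⟨fun x => (smallCopyEquiv A).symm (star (smallCopyEquiv A x))⟩

lemma smallCopyEquiv_mul (x y : SmallCopy A) :
    smallCopyEquiv A (x * y) = smallCopyEquiv A x * smallCopyEquiv A y :=
  map_mul (smallCopyEquiv A).ringEquiv x y

lemma smallCopyEquiv_add (x y : SmallCopy A) :
    smallCopyEquiv A (x + y) = smallCopyEquiv A x + smallCopyEquiv A y :=
  map_add (smallCopyEquiv A).ringEquiv x y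

lemma smallCopyEquiv_smul (c : ℂ) (x : SmallCopy A) :
    smallCopyEquiv A (c • x) = c • smallCopyEquiv A x :=
  map_smul ((smallCopyEquiv A).algEquiv ℂ) c x

lemma smallCopyEquiv_star (x : SmallCopy A) :
    smallCopyEquiv A (star x) = star (smallCopyEquiv A x) :=
  (smallCopyEquiv A).apply_symm_apply _

lemma norm_smallCopyEquiv (x : SmallCopy A) : ‖smallCopyEquiv A x‖ = ‖x‖ := rfl

lemma isometry_smallCopyEquiv : Isometry (smallCopyEquiv A) := fun _ _ => rfl

instance instCStarAlgebraSmallCopy : CStarAlgebra (SmallCopy A) where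
  star_involutive x := (smallCopyEquiv A).injective (by simp [smallCopyEquiv_star])
  star_mul x y := (smallCopyEquiv A).injective
    (by simp [smallCopyEquiv_star, smallCopyEquiv_mul])
  star_add x y := (smallCopyEquiv A).injective
    (by simp [smallCopyEquiv_star, smallCopyEquiv_add])
  complete := (completeSpace_iff_isComplete_range
    (isometry_smallCopyEquiv A).isUniformInducing |>.2 (by
      rw [(smallCopyEquiv A).surjective.range_eq]; exact isComplete_univ)).complete
  norm_mul_self_le x := by
    rw [← norm_smallCopyEquiv, ← norm_smallCopyEquiv A (star x * x), smallCopyEquiv_mul,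
      smallCopyEquiv_star, CStarRing.norm_star_mul_self]
  norm_smul_le c x := by
    rw [← norm_smallCopyEquiv, ← norm_smallCopyEquiv A x, smallCopyEquiv_smul, norm_smul]
  star_smul c x := (smallCopyEquiv A).injective
    (by simp [smallCopyEquiv_star, smallCopyEquiv_smul])

/-- The copy is *-isomorphic to the original. -/
def smallCopyStarAlgEquiv : SmallCopy A ≃⋆ₐ[ℂ] A where
  toEquiv := smallCopyEquiv A
  map_mul' := smallCopyEquiv_mul A
  map_add' := smallCopyEquiv_add A
  map_smul' := smallCopyEquiv_smul A
  map_star' := smallCopyEquiv_star A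

end SmallCopy

/-! ### The universal C⋆-algebra -/

/-- A representation of the relations: a nonzero unital C⋆-algebra with a family that satisfies
them. -/
structure Rep (q : ℂ) (n m : ℕ) where
  carrier : Type
  [cstar : CStarAlgebra carrier]
  [nontrivial : Nontrivial carrier]
  s : Fin n → carrier
  t : Fin m → carrier
  isQFamily : IsQFamily q s t

attribute [instance] Rep.cstar Rep.nontrivial

/-- The C⋆-algebra of all bounded families indexed by the representations: the `ℓ^∞`-product of
all representations. -/
abbrev RepProd (q : ℂ) (n m : ℕ) : Type 1 := lp (fun ρ : Rep q n m => ρ.carrier) ∞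

instance instCStarAlgebraRepProd (q : ℂ) (n m : ℕ) : CStarAlgebra (RepProd q n m) where

/-- The generators `s₁, …, sₙ, t₁, …, tₘ` of a representation as a single family. -/
def Rep.gen {q : ℂ} {n m : ℕ} (ρ : Rep q n m) : Fin n ⊕ Fin m → ρ.carrier := Sum.elim ρ.s ρ.t

lemma norm_le_one_of_isometry {A : Type u} [CStarAlgebra A] [Nontrivial A] {a : A}
    (h : star a * a = 1) : ‖a‖ ≤ 1 := by
  have h1 : ‖a‖ * ‖a‖ = 1 := by rw [← CStarRing.norm_star_mul_self, h, CStarRing.norm_one]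
  nlinarith [norm_nonneg a]

lemma Rep.norm_gen_le {q : ℂ} {n m : ℕ} (ρ : Rep q n m) (x : Fin n ⊕ Fin m) :
    ‖ρ.gen x‖ ≤ 1 := by
  rcases x with i | r
  · exact norm_le_one_of_isometry (by simpa [Rep.gen] using ρ.isQFamily.star_s_mul_s i i)
  · exact norm_le_one_of_isometry (by simpa [Rep.gen] using ρ.isQFamily.star_t_mul_t r r)

/-- The universal generators: in each representation they act as the generators there. -/
def prodGen (q : ℂ) (n m : ℕ) (x : Fin n ⊕ Fin m) : RepProd q n m :=
  ⟨fun ρ => ρ.gen x, memℓp_infty ⟨1, by rintro _ ⟨ρ, rfl⟩; exact ρ.norm_gen_le x⟩⟩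

/-- The C⋆-algebra `𝓔^q_{n,m}`: the universal unital C⋆-algebra generated by `s₁, …, sₙ`,
`t₁, …, tₘ` subject to the relations `IsQFamily q s t`. It is the C⋆-algebra generated by the
universal generators in the product of all representations (copied into `Type`); see
`isQFamily_sGen_tGen`, `generated_gen_eq_top` and `existsUnique_lift` for its universal
property. -/
def E (q : ℂ) (n m : ℕ) : Type := SmallCopy (generated (prodGen q n m))

instance instCStarAlgebraE (q : ℂ) (n m : ℕ) : CStarAlgebra (E q n m) :=
  instCStarAlgebraSmallCopy _

/-- The *-isomorphism with the algebra that is generated in the product of all representations. -/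
def eEquiv (q : ℂ) (n m : ℕ) : E q n m ≃⋆ₐ[ℂ] generated (prodGen q n m) :=
  smallCopyStarAlgEquiv _

/-- The generators of `𝓔^q_{n,m}` as a single family. -/
def gen (q : ℂ) (n m : ℕ) (x : Fin n ⊕ Fin m) : E q n m :=
  (eEquiv q n m).symm ⟨prodGen q n m x, mem_generated _ x⟩

/-- The generators `sᵢ` of `𝓔^q_{n,m}`. -/
def sGen (q : ℂ) (n m : ℕ) (i : Fin n) : E q n m := gen q n m (Sum.inl i)

/-- The generators `tᵣ` of `𝓔^q_{n,m}`. -/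
def tGen (q : ℂ) (n m : ℕ) (r : Fin m) : E q n m := gen q n m (Sum.inr r)

/-- Evaluation at a representation. -/
def evalRep {q : ℂ} {n m : ℕ} (ρ : Rep q n m) : RepProd q n m →⋆ₐ[ℂ] ρ.carrier where
  toFun f := f ρ
  map_one' := rfl
  map_mul' _ _ := rfl
  map_zero' := rfl
  map_add' _ _ := rfl
  commutes' _ := rfl
  map_star' _ := rfl

/-- The representation of `𝓔^q_{n,m}` given by `ρ`. -/
def toRep {q : ℂ} {n m : ℕ} (ρ : Rep q n m) : E q n m →⋆ₐ[ℂ] ρ.carrier :=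
  ((evalRep ρ).comp (generated (prodGen q n m)).subtype).comp
    (eEquiv q n m : E q n m →⋆ₐ[ℂ] generated (prodGen q n m))

lemma toRep_gen {q : ℂ} {n m : ℕ} (ρ : Rep q n m) (x : Fin n ⊕ Fin m) :
    toRep ρ (gen q n m x) = ρ.gen x := by
  have h : eEquiv q n m (gen q n m x) = ⟨prodGen q n m x, mem_generated _ x⟩ :=
    (eEquiv q n m).apply_symm_apply _
  change evalRep ρ ((eEquiv q n m (gen q n m x) : generated (prodGen q n m)) : RepProd q n m) = _
  rw [h]
  rfl

lemma ext_toRep {q : ℂ} {n m : ℕ} {a b : E q n m} (h : ∀ ρ : Rep q n m, toRep ρ a = toRep ρ b) :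
    a = b :=
  (eEquiv q n m).injective (Subtype.ext (lp.ext (funext h)))

/-- The generators satisfy the relations. -/
theorem isQFamily_sGen_tGen (q : ℂ) (n m : ℕ) : IsQFamily q (sGen q n m) (tGen q n m) where
  star_s_mul_s i j := ext_toRep fun ρ => by
    have := ρ.isQFamily.star_s_mul_s i j
    simp only [sGen, map_mul, map_star, toRep_gen]
    split_ifs with h <;> simpa [h, Rep.gen] using this
  star_t_mul_t i j := ext_toRep fun ρ => by
    have := ρ.isQFamily.star_t_mul_t i j
    simp only [tGen, map_mul, map_star, toRep_gen]
    split_ifs with h <;> simpa [h, Rep.gen] using this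
  star_s_mul_t j r := ext_toRep fun ρ => by
    have := ρ.isQFamily.star_s_mul_t j r
    simp only [sGen, tGen, map_mul, map_smul, map_star, toRep_gen]
    exact this

/-- The inclusion into the product of all representations. -/
def toProd (q : ℂ) (n m : ℕ) : E q n m →⋆ₐ[ℂ] RepProd q n m :=
  (generated (prodGen q n m)).subtype.comp
    (eEquiv q n m : E q n m →⋆ₐ[ℂ] generated (prodGen q n m))

lemma isometry_toProd (q : ℂ) (n m : ℕ) : Isometry (toProd q n m) := fun _ _ => rfl

lemma toProd_gen (q : ℂ) (n m : ℕ) (x : Fin n ⊕ Fin m) :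
    toProd q n m (gen q n m x) = prodGen q n m x :=
  congrArg Subtype.val ((eEquiv q n m).apply_symm_apply ⟨prodGen q n m x, mem_generated _ x⟩)

/-- A closed *-subalgebra that contains the generators is everything. -/
lemma eq_top_of_gen_mem {q : ℂ} {n m : ℕ} {T : StarSubalgebra ℂ (E q n m)}
    (hT : IsClosed (T : Set (E q n m))) (h : ∀ x, gen q n m x ∈ T) : T = ⊤ := by
  have hc : IsClosed (T.map (toProd q n m) : Set (RepProd q n m)) := by
    rw [StarSubalgebra.coe_map]
    exact (isometry_toProd q n m).isClosedEmbedding.isClosedMap _ hT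
  have hle : generated (prodGen q n m) ≤ T.map (toProd q n m) := by
    refine StarSubalgebra.topologicalClosure_minimal (StarAlgebra.adjoin_le ?_) hc
    rintro _ ⟨x, rfl⟩
    exact ⟨gen q n m x, h x, toProd_gen q n m x⟩
  refine eq_top_iff.2 fun a _ => ?_
  obtain ⟨b, hb, hab⟩ := hle (eEquiv q n m a).2
  have : b = a := (isometry_toProd q n m).injective hab
  exact this ▸ hb

/-- `𝓔^q_{n,m}` is generated by the generators as a C⋆-algebra. -/
theorem generated_gen_eq_top (q : ℂ) (n m : ℕ) : generated (gen q n m) = ⊤ :=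
  eq_top_of_gen_mem (isClosed_generated _) (mem_generated _)

/-- The universal property: every family in a unital C⋆-algebra (in any universe) that satisfies
the relations is the image of the generators under a unique unital *-homomorphism. -/
theorem existsUnique_lift {q : ℂ} {n m : ℕ} {B : Type u} [CStarAlgebra B]
    {s : Fin n → B} {t : Fin m → B} (h : IsQFamily q s t) :
    ∃! φ : E q n m →⋆ₐ[ℂ] B, (∀ i, φ (sGen q n m i) = s i) ∧ ∀ r, φ (tGen q n m r) = t r := by
  refine existsUnique_of_exists_of_unique ?_ ?_
  · rcases subsingleton_or_nontrivial B with hB | hB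
    · exact ⟨{ toFun := fun _ => 0
               map_one' := Subsingleton.elim _ _
               map_mul' := fun _ _ => Subsingleton.elim _ _
               map_zero' := rfl
               map_add' := fun _ _ => Subsingleton.elim _ _
               commutes' := fun _ => Subsingleton.elim _ _
               map_star' := fun _ => Subsingleton.elim _ _ },
        fun _ => Subsingleton.elim _ _, fun _ => Subsingleton.elim _ _⟩
    · let g : Fin n ⊕ Fin m → B := Sum.elim s t
      let e := smallCopyStarAlgEquiv (generated g)
      let f : SmallCopy (generated g) →⋆ₐ[ℂ] B :=
        (generated g).subtype.comp (e : SmallCopy (generated g) →⋆ₐ[ℂ] generated g)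
      have hf : Function.Injective f := Subtype.val_injective.comp e.injective
      let g' : Fin n ⊕ Fin m → SmallCopy (generated g) :=
        fun x => e.symm ⟨g x, mem_generated g x⟩
      have hg' : ∀ x, f (g' x) = g x := fun x =>
        congrArg Subtype.val (e.apply_symm_apply ⟨g x, mem_generated g x⟩)
      have : Nontrivial (SmallCopy (generated g)) := e.toEquiv.nontrivial
      let ρ : Rep q n m :=
        { carrier := SmallCopy (generated g)
          s := fun i => g' (Sum.inl i)
          t := fun r => g' (Sum.inr r)
          isQFamily :=
            { star_s_mul_s := fun i j => hf (by
                simp only [map_mul, map_star, hg']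
                have := h.star_s_mul_s i j
                split_ifs with hij <;> simpa [hij, g] using this)
              star_t_mul_t := fun i j => hf (by
                simp only [map_mul, map_star, hg']
                have := h.star_t_mul_t i j
                split_ifs with hij <;> simpa [hij, g] using this)
              star_s_mul_t := fun i j => hf (by
                simp only [map_mul, map_smul, map_star, hg']
                exact h.star_s_mul_t i j) } }
      refine ⟨f.comp (toRep ρ), fun i => ?_, fun r => ?_⟩
      · exact (congrArg f (toRep_gen ρ (Sum.inl i))).trans (hg' (Sum.inl i))
      · exact (congrArg f (toRep_gen ρ (Sum.inr r))).trans (hg' (Sum.inr r))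
  · rintro φ ψ ⟨hφs, hφt⟩ ⟨hψs, hψt⟩
    have hclosed : IsClosed (StarAlgHom.equalizer φ ψ : Set (E q n m)) :=
      isClosed_eq (NonUnitalStarAlgHom.instContinuousLinearMapClassComplex.map_continuous φ)
        (NonUnitalStarAlgHom.instContinuousLinearMapClassComplex.map_continuous ψ)
    have htop : StarAlgHom.equalizer φ ψ = ⊤ := eq_top_of_gen_mem hclosed (by
      rintro (i | r)
      · exact (hφs i).trans (hψs i).symm
      · exact (hφt r).trans (hψt r).symm)
    ext a
    have ha : a ∈ StarAlgHom.equalizer φ ψ := htop ▸ StarSubalgebra.mem_top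
    exact ha

/-! ### Ideals -/

/-- `Q = ∑ⱼ sⱼ sⱼ*`. -/
def projQ (q : ℂ) (n m : ℕ) : E q n m := ∑ j, sGen q n m j * star (sGen q n m j)

/-- `P = ∑ᵣ tᵣ tᵣ*`. -/
def projP (q : ℂ) (n m : ℕ) : E q n m := ∑ r, tGen q n m r * star (tGen q n m r)

/-- The closed two-sided ideal generated by a set: the smallest closed two-sided ideal that
contains it. -/
def closedIdealSpan {A : Type u} [CStarAlgebra A] (S : Set A) : TwoSidedIdeal A :=
  sInf {J : TwoSidedIdeal A | IsClosed (J : Set A) ∧ S ⊆ J}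

/-- The ideal `𝓜_q` of `𝓔^q_{n,m}`, generated by `1 - P` and `1 - Q`. -/
def idealM (q : ℂ) (n m : ℕ) : TwoSidedIdeal (E q n m) :=
  closedIdealSpan {1 - projP q n m, 1 - projQ q n m}

/-- The proper ideals of a C⋆-algebra (closed and two-sided, as usual for C⋆-algebras). -/
def properIdeals (A : Type u) [CStarAlgebra A] : Set (TwoSidedIdeal A) :=
  {J | IsClosed (J : Set A) ∧ J ≠ ⊤}

end QTensor

end

noncomputable section

namespace QTensor

/-! ### Words in isometries with orthogonal ranges -/

section Word

variable {A : Type*} [Ring A] {ι : Type*}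

/-! Properness: operators on `ℓ²` satisfying the relations with `P = Q = 1` give a nonzero
representation that kills `𝓜_q` (`exists_isQFamily`).

Maximality: let `x ∉ 𝓜_q` lie in an ideal `J`; the aim is an element of `J` so close to a nonzero
scalar that it is invertible. Let `R_k` be the sum of the range projections of the isometries `s_κ
t_l` with `|κ| = |l| = k`. Since `1 - R_k ∈ 𝓜_q`, the norm of `x R_k` is at least the distance `δ`
from `x` to `𝓜_q`, for every `k`. Put `y = x⋆x ∈ J`. Averaging `y` over the gauge action keeps a
fixed fraction of its norm under compression by `R_k`, because the terms are positive and those near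
the identity of the torus are close to `y` (`exists_norm_le_norm_torusAverage`).

Approximate `y` by a polynomial `p` in monomials `s_μ s_ν⋆ t_α t_β⋆` with words of length at most
`K`. The average of `p` contains only monomials of degree zero, and on the range of `R_K` it is a
matrix over the matrix units `V_w V_w'⋆`, where `V_w = s_κ t_l`. A matrix of large norm can be
compressed to a large scalar `c` by combinations `a`, `b` of the `V_w`
(`exists_star_mul_matrixHom_mul_eq_smul_one`). Multiplying `a` and `b` on the right by a further
isometry `f`, a product of the non-periodic words `i ⋯ i j`, makes the monomials of nonzero degree
vanish, so `p` itself is compressed to `c` (`compression_eq_compression_gaugeAverage`). The same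
compression of `y` lies in `J` and is close to `c`. Two distinct letters in each alphabet are what
makes `f` available. -/

/-- The product of the letters of a word. -/
def word (x : ι → A) (l : List ι) : A := (l.map x).prod

@[simp] lemma word_nil (x : ι → A) : word x [] = 1 := rfl

@[simp] lemma word_cons (x : ι → A) (i : ι) (l : List ι) : word x (i :: l) = x i * word x l := by
  simp [word]

lemma word_append (x : ι → A) (l l' : List ι) : word x (l ++ l') = word x l * word x l' := by
  simp [word]

variable [StarRing A] [DecidableEq ι] {x : ι → A} (hx : ∀ i j, star (x i) * x j = if i = j then 1 else 0)

include hx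

lemma star_cons_mul_cons (i j : ι) (a b : A) :
    star (x i * a) * (x j * b) = if i = j then star a * b else 0 := by
  rw [star_mul, mul_assoc, ← mul_assoc (star (x i)), hx]
  split_ifs <;> simp

/-- Letters cancel in pairs from the left: either the shorter word is a prefix of the longer one and
a tail remains, or the first mismatch kills the product. -/
lemma star_word_mul_word_of_le {a b : List ι} (h : a.length ≤ b.length) :
    star (word x a) * word x b = word x (b.drop a.length) ∨ star (word x a) * word x b = 0 := by
  induction a generalizing b with
  | nil => simp
  | cons i a ih =>
    cases b with
    | nil => simp at h
    | cons j b =>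
      simp only [word_cons, star_cons_mul_cons hx]
      split_ifs
      · simpa using ih (by simpa using h)
      · simp

lemma star_word_mul_word_of_length_eq {a b : List ι} (h : a.length = b.length) :
    star (word x a) * word x b = if a = b then 1 else 0 := by
  induction a generalizing b with
  | nil => simp [List.length_eq_zero_iff.1 h.symm]
  | cons i a ih =>
    cases b with
    | nil => simp at h
    | cons j b =>
      simp only [word_cons, star_cons_mul_cons hx, List.cons.injEq, ite_and]
      rw [ih (by simpa using h)]

lemma star_word_mul_word_self (a : List ι) : star (word x a) * word x a = 1 := by
  rw [star_word_mul_word_of_length_eq hx rfl, if_pos rfl]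

lemma star_word_mul_word_eq_zero {a b : List ι} {k : ℕ} {i j : ι} (hij : i ≠ j)
    (ha : a[k]? = some i) (hb : b[k]? = some j) : star (word x a) * word x b = 0 := by
  induction a generalizing b k with
  | nil => simp at ha
  | cons i' a ih =>
    cases b with
    | nil => simp at hb
    | cons j' b =>
      simp only [word_cons, star_cons_mul_cons hx]
      split_ifs with h
      · cases k with
        | zero => simp_all
        | succ k => exact ih (by simpa using ha) (by simpa using hb)
      · rfl

/-- Compressing by words that end in `i ⋯ i j` kills the monomials of nonzero degree. -/
lemma star_word_mul_monomial_mul_word_eq_zero {i j : ι} (hij : i ≠ j) {k : ℕ} {a b μ ν : List ι}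
    (ha : a.length = k) (hb : b.length = k) (hμ : μ.length ≤ k) (hν : ν.length ≤ k)
    (h : μ.length ≠ ν.length) :
    star (word x (a ++ (List.replicate k i ++ [j]))) * (word x μ * star (word x ν)) *
      word x (b ++ (List.replicate k i ++ [j])) = 0 := by
  set a' := a ++ (List.replicate k i ++ [j]) with ha'
  set b' := b ++ (List.replicate k i ++ [j]) with hb'
  have hla : a'.length = k + (k + 1) := by simp [ha', ha]
  have hlb : b'.length = k + (k + 1) := by simp [hb', hb]
  have key : ∀ {c : List ι}, c.length = k →
      (c ++ (List.replicate k i ++ [j]))[k + k]? = some j ∧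
      ∀ p, k ≤ p → p < k + k → (c ++ (List.replicate k i ++ [j]))[p]? = some i := by
    intro c hc
    constructor
    · rw [List.getElem?_append_right (by omega), List.getElem?_append_right (by simp; omega)]
      simp [hc]
    · intro p h1 h2
      rw [List.getElem?_append_right (by omega), List.getElem?_append_left (by simp; omega)]
      rw [List.getElem?_replicate, if_pos (by omega)]
  have h1 : star (word x a') * word x μ = star (word x (a'.drop μ.length)) ∨
      star (word x a') * word x μ = 0 := by
    rcases star_word_mul_word_of_le hx (a := μ) (b := a') (by omega) with h | h
    · left; rw [← h, star_mul, star_star]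
    · right; rw [← star_star (word x μ), ← star_mul, h, star_zero]
  have h2 := star_word_mul_word_of_le hx (a := ν) (b := b') (by omega)
  -- The letter `j` sits at position `k + k` in both words, preceded by `k` letters `i`. Dropping
  -- different numbers of letters, both at most `k`, aligns the `j` of one word with an `i` of the
  -- other.
  have h3 : star (word x (a'.drop μ.length)) * word x (b'.drop ν.length) = 0 := by
    rcases lt_or_gt_of_ne h with h | h
    · refine star_word_mul_word_eq_zero hx (k := k + k - ν.length) (i := i) (j := j) hij ?_ ?_
      · rw [List.getElem?_drop]
        exact (key ha).2 _ (by omega) (by omega)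
      · rw [List.getElem?_drop, show ν.length + (k + k - ν.length) = k + k by omega]
        exact (key hb).1
    · refine star_word_mul_word_eq_zero hx (k := k + k - μ.length) (i := j) (j := i) hij.symm ?_ ?_
      · rw [List.getElem?_drop, show μ.length + (k + k - μ.length) = k + k by omega]
        exact (key ha).1
      · rw [List.getElem?_drop]
        exact (key hb).2 _ (by omega) (by omega)
  rw [← mul_assoc, mul_assoc]
  rcases h1 with h1 | h1 <;> rcases h2 with h2 | h2 <;> rw [h1, h2] <;> simp [h3]

/-- A monomial of degree zero maps long words to words of the same length. -/
lemma monomial_mul_word {μ ν a : List ι} (h : μ.length = ν.length) (hν : ν.length ≤ a.length) :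
    (∃ b : List ι, b.length = a.length ∧ word x μ * star (word x ν) * word x a = word x b) ∨
      word x μ * star (word x ν) * word x a = 0 := by
  rw [mul_assoc]
  rcases star_word_mul_word_of_le hx hν with h' | h'
  · exact .inl ⟨μ ++ a.drop ν.length, by simp; omega, by rw [h', word_append]⟩
  · exact .inr (by rw [h', mul_zero])

/-- The set of monomials `word μ * star (word ν)` is, up to zero, stable under left
multiplication by the adjoints of the letters. -/
lemma star_letter_mul_monomial (i : ι) (μ ν : List ι) :
    (∃ μ' ν', star (x i) * (word x μ * star (word x ν)) = word x μ' * star (word x ν')) ∨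
      star (x i) * (word x μ * star (word x ν)) = 0 := by
  cases μ with
  | nil => exact .inl ⟨[], ν ++ [i], by simp [word_append]⟩
  | cons j μ =>
    rw [word_cons, ← mul_assoc, ← mul_assoc, hx]
    split_ifs
    · exact .inl ⟨μ, ν, by simp⟩
    · simp

-- Write `p_k` for the sum over words of length `k`. The induction rests on `1 - p_(k+1) = (1 - p_1)
-- + ∑ xᵢ (1 - p_k) xᵢ⋆`.
omit hx [DecidableEq ι] in
lemma one_sub_sum_word_mem [Fintype ι] {I : TwoSidedIdeal A}
    (h : 1 - ∑ i, x i * star (x i) ∈ I) (k : ℕ) :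
    1 - ∑ v : List.Vector ι k, word x v.1 * star (word x v.1) ∈ I := by
  induction k with
  | zero =>
    have : ∑ v : List.Vector ι 0, word x v.1 * star (word x v.1) = 1 := by
      rw [Fintype.sum_subsingleton _ List.Vector.nil]
      simp [List.Vector.nil]
    rw [this, sub_self]
    exact I.zero_mem
  | succ k ih =>
    let e : ι × List.Vector ι k ≃ List.Vector ι (k + 1) :=
      { toFun := fun p => p.1 ::ᵥ p.2
        invFun := fun v => (v.head, v.tail)
        left_inv := fun p => by simp
        right_inv := fun v => by simp }
    have he : ∑ v : List.Vector ι (k + 1), word x v.1 * star (word x v.1) =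
        ∑ i, x i * (∑ v : List.Vector ι k, word x v.1 * star (word x v.1)) * star (x i) := by
      rw [← e.sum_comp, Fintype.sum_prod_type]
      refine Finset.sum_congr rfl fun i _ => ?_
      rw [Finset.mul_sum, Finset.sum_mul]
      refine Finset.sum_congr rfl fun v _ => ?_
      have : (e (i, v)).1 = i :: v.1 := by
        obtain ⟨v, hv⟩ := v
        rfl
      rw [this, word_cons, star_mul]
      simp only [mul_assoc]
    have h2 : 1 - ∑ v : List.Vector ι (k + 1), word x v.1 * star (word x v.1) =
        (1 - ∑ i, x i * star (x i)) +
        ∑ i, x i * (1 - ∑ v : List.Vector ι k, word x v.1 * star (word x v.1)) * star (x i) := by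
      rw [he]
      simp only [mul_sub, sub_mul, mul_one, Finset.sum_sub_distrib]
      abel
    rw [h2]
    exact I.add_mem h (sum_mem fun i _ => I.mul_mem_right _ _ (I.mul_mem_left _ _ ih))

end Word

/-! ### Commutation up to a scalar -/

section QComm

variable {A : Type*} [Ring A] [Algebra ℂ A]

/-- Commutation up to a scalar. -/
def QComm (a b : A) : Prop := ∃ c : ℂ, a * b = c • (b * a)

lemma QComm.mul_right {a b b' : A} (h : QComm a b) (h' : QComm a b') : QComm a (b * b') := by
  obtain ⟨c, hc⟩ := h
  obtain ⟨c', hc'⟩ := h'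
  refine ⟨c * c', ?_⟩
  rw [← mul_assoc, hc, smul_mul_assoc, mul_assoc, hc', mul_smul_comm, smul_smul, mul_assoc]

lemma QComm.mul_left {a a' b : A} (h : QComm a b) (h' : QComm a' b) : QComm (a * a') b := by
  obtain ⟨c, hc⟩ := h
  obtain ⟨c', hc'⟩ := h'
  refine ⟨c' * c, ?_⟩
  rw [mul_assoc, hc', mul_smul_comm, ← mul_assoc, hc, smul_mul_assoc, smul_smul, mul_assoc]

lemma QComm.one_right (a : A) : QComm a 1 := ⟨1, by simp⟩

lemma QComm.one_left (a : A) : QComm 1 a := ⟨1, by simp⟩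

/-- The scalars multiply along a product. Their values are never needed later, which is why `QComm`
hides them in an existential. -/
lemma QComm.of_mem_closure {X Y : Set A} (h : ∀ a ∈ X, ∀ b ∈ Y, QComm a b) {a b : A}
    (ha : a ∈ Submonoid.closure X) (hb : b ∈ Submonoid.closure Y) : QComm a b := by
  induction ha using Submonoid.closure_induction with
  | mem a ha =>
    induction hb using Submonoid.closure_induction with
    | mem b hb => exact h a ha b hb
    | one => exact .one_right a
    | mul b b' _ _ h h' => exact h.mul_right h'
  | one => exact .one_left b
  | mul a a' _ _ h h' => exact h.mul_left h'
end QComm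

section StarWords

variable {A : Type*} [Ring A] [StarRing A] {ι : Type*}

/-- The products of letters and of their adjoints. -/
def starWords (x : ι → A) : Submonoid A :=
  Submonoid.closure (Set.range x ∪ Set.range fun i => star (x i))

lemma letter_mem_starWords (x : ι → A) (i : ι) : x i ∈ starWords x :=
  Submonoid.subset_closure (.inl ⟨i, rfl⟩)

lemma star_letter_mem_starWords (x : ι → A) (i : ι) : star (x i) ∈ starWords x :=
  Submonoid.subset_closure (.inr ⟨i, rfl⟩)

lemma word_mem_starWords (x : ι → A) (l : List ι) : word x l ∈ starWords x := by
  induction l with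
  | nil => exact one_mem _
  | cons i l ih => exact word_cons x i l ▸ mul_mem (letter_mem_starWords x i) ih

lemma star_word_mem_starWords (x : ι → A) (l : List ι) : star (word x l) ∈ starWords x := by
  induction l with
  | nil => simp
  | cons i l ih =>
    rw [word_cons, star_mul]
    exact mul_mem ih (star_letter_mem_starWords x i)

end StarWords

/-! ### Weighted shifts on `ℓ²` and a representation with `P = Q = 1` -/

section Shift

variable {X : Type} [DecidableEq X]

/-- The Hilbert space `ℓ²(X)`. -/
abbrev EllTwo (X : Type) : Type := lp (fun _ : X => ℂ) 2

/-- The basis vectors of `ℓ²(X)`. -/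
def basisVec (x : X) : EllTwo X := lp.single 2 x 1

lemma ext_basisVec {F : Type*} [AddCommGroup F] [Module ℂ F] [TopologicalSpace F] [T2Space F]
    {f g : EllTwo X →L[ℂ] F} (h : ∀ x, f (basisVec x) = g (basisVec x)) : f = g := by
  refine lp.ext_continuousLinearMap (by simp) fun x => ?_
  ext
  simpa [basisVec] using h x

lemma inner_basisVec_left (x : X) (f : EllTwo X) : inner ℂ (basisVec x) f = f x := by
  simp [basisVec, lp.inner_single_left]

lemma norm_basisVec (x : X) : ‖basisVec x‖ = 1 := by
  simp [basisVec, lp.norm_single]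

lemma inner_basisVec (x y : X) : inner ℂ (basisVec x) (basisVec y) = if x = y then (1 : ℂ) else 0 := by
  rw [inner_basisVec_left, basisVec, lp.single_apply]
  simp [Pi.single_apply]

lemma orthogonalFamily_weightedShift {σ : X → X} (hσ : Function.Injective σ) {c : X → ℂ}
    (hc : ∀ x, ‖c x‖ = 1) :
    OrthogonalFamily ℂ (fun _ : X => ℂ) fun x => LinearIsometry.toSpanSingleton ℂ (EllTwo X)
      (v := c x • basisVec (σ x)) (by rw [norm_smul, hc, norm_basisVec, one_mul]) := by
  intro x y hxy a b
  simp [inner_smul_left, inner_smul_right, inner_basisVec, hσ.ne hxy]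

/-- The weighted shift `e_x ↦ c x • e_{σ x}`. -/
def weightedShift {σ : X → X} (hσ : Function.Injective σ) {c : X → ℂ} (hc : ∀ x, ‖c x‖ = 1) :
    EllTwo X →L[ℂ] EllTwo X :=
  (orthogonalFamily_weightedShift hσ hc).linearIsometry.toContinuousLinearMap

lemma weightedShift_basisVec {σ : X → X} (hσ : Function.Injective σ) {c : X → ℂ}
    (hc : ∀ x, ‖c x‖ = 1) (x : X) :
    weightedShift hσ hc (basisVec x) = c x • basisVec (σ x) := by
  refine ((orthogonalFamily_weightedShift hσ hc).linearIsometry_apply_single (i := x) (1 : ℂ)).trans ?_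
  simp

lemma star_weightedShift_mul_self {σ : X → X} (hσ : Function.Injective σ) {c : X → ℂ}
    (hc : ∀ x, ‖c x‖ = 1) : star (weightedShift hσ hc) * weightedShift hσ hc = 1 :=
  (ContinuousLinearMap.norm_map_iff_adjoint_comp_self _).1
    (orthogonalFamily_weightedShift hσ hc).linearIsometry.norm_map

lemma star_weightedShift_mul_eq_zero {σ τ : X → X} (hσ : Function.Injective σ)
    (hτ : Function.Injective τ) {c d : X → ℂ} (hc : ∀ x, ‖c x‖ = 1) (hd : ∀ x, ‖d x‖ = 1)
    (h : ∀ x y, σ x ≠ τ y) : star (weightedShift hσ hc) * weightedShift hτ hd = 0 := by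
  refine ext_basisVec fun y => ?_
  ext x
  rw [← inner_basisVec_left, mul_apply_eq_comp, ContinuousLinearMap.star_eq_adjoint,
    ContinuousLinearMap.adjoint_inner_right, weightedShift_basisVec, weightedShift_basisVec]
  simp [inner_smul_left, inner_smul_right, inner_basisVec, h]

/-- Weighted shifts along maps whose ranges partition `X` satisfy the Cuntz relations. -/
lemma sum_weightedShift_mul_star {ι : Type*} [Fintype ι] [DecidableEq ι] {σ : ι → X → X}
    (hσ : ∀ i, Function.Injective (σ i)) {c : X → ℂ} (hc : ∀ x, ‖c x‖ = 1)
    (hd : ∀ i j, i ≠ j → ∀ x y, σ i x ≠ σ j y) (hs : ∀ y, ∃ i x, σ i x = y) :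
    ∑ i, weightedShift (hσ i) hc * star (weightedShift (hσ i) hc) = 1 := by
  refine ext_basisVec fun y => ?_
  obtain ⟨i, x, rfl⟩ := hs y
  have hcx : c x ≠ 0 := fun h => by simpa [h] using hc x
  have h1 : basisVec (σ i x) = (c x)⁻¹ • weightedShift (hσ i) hc (basisVec x) := by
    rw [weightedShift_basisVec, smul_smul, inv_mul_cancel₀ hcx, one_smul]
  rw [h1, map_smul, map_smul]
  congr 1
  rw [← mul_apply_eq_comp, Finset.sum_mul, Finset.sum_eq_single i]
  · rw [mul_assoc, star_weightedShift_mul_self, mul_one]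
    rfl
  · intro j _ hj
    rw [mul_assoc, star_weightedShift_mul_eq_zero _ _ _ _ (hd j i hj), mul_zero]
  · simp

end Shift

/-- With `P = Q = 1` the relation `t s = q s t` implies `s⋆ t = q t s⋆`. -/
lemma isQFamily_of_commutation {q : ℂ} {n m : ℕ} {A : Type*} [CStarAlgebra A]
    {s : Fin n → A} {t : Fin m → A} (hs : ∀ i j, star (s i) * s j = if i = j then 1 else 0)
    (ht : ∀ i j, star (t i) * t j = if i = j then 1 else 0) (hQ : ∑ i, s i * star (s i) = 1)
    (hst : ∀ i r, t r * s i = q • (s i * t r)) : IsQFamily q s t where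
  star_s_mul_s := hs
  star_t_mul_t := ht
  star_s_mul_t j r := by
    calc star (s j) * t r = star (s j) * t r * ∑ i, s i * star (s i) := by rw [hQ, mul_one]
      _ = ∑ i, q • ((star (s j) * s i) * (t r * star (s i))) := by
        rw [Finset.mul_sum]
        refine Finset.sum_congr rfl fun i _ => ?_
        rw [mul_assoc, ← mul_assoc (t r), hst, smul_mul_assoc, mul_smul_comm]
        simp only [mul_assoc]
      _ = q • (t r * star (s j)) := by simp [hs]

/-- The `sᵢ` append a base-`n` digit to the first coordinate and the `tᵣ` a base-`m` digit to the
second. The third coordinate `z` counts applications of the `tᵣ`; the weight `q ^ (-z)` carried by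
`sᵢ` produces `t s = q s t`. It ranges over `ℤ` so that the `tᵣ` still cover every basis vector. -/
lemma exists_isQFamily {q : ℂ} (hq : ‖q‖ = 1) {n m : ℕ} (hn : n ≠ 0) (hm : m ≠ 0) :
    ∃ (s : Fin n → EllTwo (ℕ × ℕ × ℤ) →L[ℂ] EllTwo (ℕ × ℕ × ℤ))
      (t : Fin m → EllTwo (ℕ × ℕ × ℤ) →L[ℂ] EllTwo (ℕ × ℕ × ℤ)),
      IsQFamily q s t ∧ ∑ i, s i * star (s i) = 1 ∧ ∑ r, t r * star (t r) = 1 := by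
  have : NeZero n := ⟨hn⟩
  have : NeZero m := ⟨hm⟩
  let σ : Fin n → ℕ × ℕ × ℤ → ℕ × ℕ × ℤ := fun i x =>
    ((Nat.divModEquiv n).symm (x.1, i), x.2.1, x.2.2)
  let τ : Fin m → ℕ × ℕ × ℤ → ℕ × ℕ × ℤ := fun r x =>
    (x.1, (Nat.divModEquiv m).symm (x.2.1, r), x.2.2 + 1)
  have hσ : ∀ i, Function.Injective (σ i) := by
    rintro i ⟨a, b, c⟩ ⟨a', b', c'⟩ h
    simp only [σ, Prod.mk.injEq, EmbeddingLike.apply_eq_iff_eq] at h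
    simp [h]
  have hτ : ∀ r, Function.Injective (τ r) := by
    rintro r ⟨a, b, c⟩ ⟨a', b', c'⟩ h
    simp only [τ, Prod.mk.injEq, EmbeddingLike.apply_eq_iff_eq, add_left_inj] at h
    simp [h]
  have hσ' : ∀ i j, i ≠ j → ∀ x y, σ i x ≠ σ j y := by
    rintro i j hij ⟨a, b, c⟩ ⟨a', b', c'⟩ h
    simp only [σ, Prod.mk.injEq, EmbeddingLike.apply_eq_iff_eq] at h
    exact hij h.1.2
  have hτ' : ∀ i j, i ≠ j → ∀ x y, τ i x ≠ τ j y := by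
    rintro i j hij ⟨a, b, c⟩ ⟨a', b', c'⟩ h
    simp only [τ, Prod.mk.injEq, EmbeddingLike.apply_eq_iff_eq] at h
    exact hij h.2.1.2
  have hσs : ∀ y, ∃ i x, σ i x = y := by
    rintro ⟨a, b, c⟩
    exact ⟨(Nat.divModEquiv n a).2, ((Nat.divModEquiv n a).1, b, c), by
      simp only [σ, Prod.mk.eta, Equiv.symm_apply_apply]⟩
  have hτs : ∀ y, ∃ i x, τ i x = y := by
    rintro ⟨a, b, c⟩
    exact ⟨(Nat.divModEquiv m b).2, (a, (Nat.divModEquiv m b).1, c - 1), by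
      simp only [τ, Prod.mk.eta, Equiv.symm_apply_apply, sub_add_cancel]⟩
  have hc : ∀ x : ℕ × ℕ × ℤ, ‖q ^ (-x.2.2)‖ = 1 := fun x => by simp [hq]
  have hc' : ∀ x : ℕ × ℕ × ℤ, ‖(1 : ℂ)‖ = 1 := fun x => norm_one
  have hq0 : q ≠ 0 := fun h => by simp [h] at hq
  refine ⟨fun i => weightedShift (hσ i) hc, fun r => weightedShift (hτ r) hc',
    isQFamily_of_commutation (fun i j => ?_) (fun i j => ?_) ?_ (fun i r => ?_), ?_, ?_⟩
  · split_ifs with h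
    · subst h
      exact star_weightedShift_mul_self _ _
    · exact star_weightedShift_mul_eq_zero _ _ _ _ (hσ' i j h)
  · split_ifs with h
    · subst h
      exact star_weightedShift_mul_self _ _
    · exact star_weightedShift_mul_eq_zero _ _ _ _ (hτ' i j h)
  · exact sum_weightedShift_mul_star hσ hc hσ' hσs
  · refine ext_basisVec fun x => ?_
    simp only [smul_apply, mul_apply_eq_comp,
      weightedShift_basisVec, map_smul, smul_smul]
    congr 1
    simp [τ, zpow_add₀ hq0, mul_comm, hq0]
  · exact sum_weightedShift_mul_star hσ hc hσ' hσs
  · exact sum_weightedShift_mul_star hτ hc' hτ' hτs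

/-! ### Closed ideals and properness of `𝓜_q` -/

lemma isClosed_closedIdealSpan {A : Type*} [CStarAlgebra A] (S : Set A) :
    IsClosed (closedIdealSpan S : Set A) := by
  have : (closedIdealSpan S : Set A) =
      ⋂ J ∈ {J : TwoSidedIdeal A | IsClosed (J : Set A) ∧ S ⊆ J}, (J : Set A) := by
    ext x
    simp [closedIdealSpan, TwoSidedIdeal.mem_sInf]
  rw [this]
  exact isClosed_biInter fun J hJ => hJ.1

lemma subset_closedIdealSpan {A : Type*} [CStarAlgebra A] (S : Set A) :
    S ⊆ (closedIdealSpan S : Set A) := fun _ hx =>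
  (TwoSidedIdeal.mem_sInf A).2 fun _ hJ => hJ.2 hx

/-- The ideal `𝓜_q` is proper. -/
theorem idealM_mem_properIdeals {q : ℂ} (hq : ‖q‖ = 1) {n m : ℕ} (hn : n ≠ 0) (hm : m ≠ 0) :
    idealM q n m ∈ properIdeals (E q n m) := by
  refine ⟨isClosed_closedIdealSpan _, fun htop => ?_⟩
  obtain ⟨s, t, h, hQ, hP⟩ := exists_isQFamily hq hn hm
  obtain ⟨φ, ⟨hφs, hφt⟩, -⟩ := existsUnique_lift h
  have hφ : Continuous φ := NonUnitalStarAlgHom.instContinuousLinearMapClassComplex.map_continuous φ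
  have hker : ∀ x, x ∈ TwoSidedIdeal.ker φ ↔ φ x = 0 := fun x => TwoSidedIdeal.mem_ker φ
  have hstar : ∀ x, φ (star x) = star (φ x) := map_star φ
  -- The kernel is closed and contains `1 - P` and `1 - Q`, but not `1`.
  have hle : idealM q n m ≤ TwoSidedIdeal.ker φ := by
    refine sInf_le ⟨?_, ?_⟩
    · have : (TwoSidedIdeal.ker φ : Set (E q n m)) = φ ⁻¹' {0} := by
        ext x
        exact hker x
      rw [this]
      exact isClosed_singleton.preimage hφ
    · rintro x (rfl | rfl)
      · simp [hker, projP, hstar, hφt, hP]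
      · simp [hker, projQ, hstar, hφs, hQ]
  have h1 : (1 : E q n m) ∈ TwoSidedIdeal.ker φ := hle (htop ▸ TwoSidedIdeal.mem_top _)
  rw [hker, map_one] at h1
  have h2 := congrArg (fun f : EllTwo (ℕ × ℕ × ℤ) →L[ℂ] EllTwo (ℕ × ℕ × ℤ) =>
    ‖f (basisVec 0)‖) h1
  simp [norm_basisVec] at h2

/-! ### Monomials in a `q`-family -/

/-- Interchange law used to separate the `s`-part of a product from its `t`-part. -/
lemma QComm.mul_mul_mul {A : Type*} [Ring A] [Algebra ℂ A] {b x : A} (h : QComm b x) (a y : A) :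
    ∃ c : ℂ, (a * b) * (x * y) = c • ((a * x) * (b * y)) := by
  obtain ⟨c, hc⟩ := h
  refine ⟨c, ?_⟩
  rw [mul_assoc, ← mul_assoc b, hc, smul_mul_assoc, mul_smul_comm]
  simp only [mul_assoc]

section Family

variable {q : ℂ} {n m : ℕ} {A : Type*} [CStarAlgebra A] {s : Fin n → A} {t : Fin m → A}

/-- The monomials `s_μ s_ν⋆ t_α t_β⋆`. -/
def monomial (s : Fin n → A) (t : Fin m → A) (μ ν : List (Fin n)) (α β : List (Fin m)) : A :=
  word s μ * star (word s ν) * (word t α * star (word t β))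

/-- Pairs of words of length `k`. -/
abbrev WordPair (n m k : ℕ) : Type := List.Vector (Fin n) k × List.Vector (Fin m) k

/-- The isometries `s_κ t_l` with `κ` and `l` of length `k`. -/
def pairWord (s : Fin n → A) (t : Fin m → A) {k : ℕ} (w : WordPair n m k) : A :=
  word s w.1.1 * word t w.2.1

variable (hst : IsQFamily q s t)

include hst

lemma star_t_mul_s (j : Fin n) (r : Fin m) :
    star (t r) * s j = star q • (s j * star (t r)) := by
  have := congrArg star (hst.star_s_mul_t j r)
  simpa using this

/-- The difference `d = t s - q s t` satisfies `d⋆d = 1 - q q̄ - q̄ q + q̄ q = 0` when `|q| = 1`, so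
the C⋆-identity gives `d = 0`. -/
lemma t_mul_s (hq : ‖q‖ = 1) (j : Fin n) (r : Fin m) : t r * s j = q • (s j * t r) := by
  have hs := hst.star_s_mul_s j j
  have ht := hst.star_t_mul_t r r
  rw [if_pos rfl] at hs ht
  have hqq : star q * q = 1 := by
    have := Complex.conj_mul' q
    rw [hq] at this
    simpa using this
  have h1 : star (s j) * star (t r) * (t r * s j) = 1 := by
    rw [mul_assoc, ← mul_assoc (star (t r)), ht, one_mul, hs]
  have h2 : star (s j) * star (t r) * (s j * t r) = star q • 1 := by
    rw [mul_assoc, ← mul_assoc (star (t r)), star_t_mul_s hst, smul_mul_assoc, mul_smul_comm,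
      mul_assoc (s j), ht, mul_one, hs]
  have h3 : star (t r) * star (s j) * (t r * s j) = q • 1 := by
    rw [mul_assoc, ← mul_assoc (star (s j)), hst.star_s_mul_t, smul_mul_assoc, mul_smul_comm,
      mul_assoc (t r), hs, mul_one, ht]
  have h4 : star (t r) * star (s j) * (s j * t r) = 1 := by
    rw [mul_assoc, ← mul_assoc (star (s j)), hs, one_mul, ht]
  rw [← sub_eq_zero, ← CStarRing.star_mul_self_eq_zero_iff]
  simp only [star_sub, star_mul, star_smul, sub_mul, mul_sub, smul_mul_assoc, mul_smul_comm, h1,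
    h2, h3, h4, smul_smul]
  rw [hqq]
  simp

lemma qComm_starWords (hq : ‖q‖ = 1) {a b : A} (ha : a ∈ starWords t) (hb : b ∈ starWords s) :
    QComm a b := by
  have hqq : star q * q = 1 := by
    have := Complex.conj_mul' q
    rw [hq] at this
    simpa using this
  refine QComm.of_mem_closure ?_ ha hb
  rintro _ (⟨r, rfl⟩ | ⟨r, rfl⟩) _ (⟨j, rfl⟩ | ⟨j, rfl⟩)
  · exact ⟨q, t_mul_s hst hq j r⟩
  · refine ⟨star q, ?_⟩
    rw [hst.star_s_mul_t, smul_smul, hqq, one_smul]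
  · exact ⟨star q, star_t_mul_s hst j r⟩
  · refine ⟨q, ?_⟩
    have := congrArg star (t_mul_s hst hq j r)
    simp only [star_mul, star_smul] at this
    rw [this, smul_smul, mul_comm, hqq, one_smul]

lemma star_pairWord_mul_pairWord {k : ℕ} (w w' : WordPair n m k) :
    star (pairWord s t w) * pairWord s t w' = if w = w' then 1 else 0 := by
  rw [pairWord, pairWord, star_mul, mul_assoc, ← mul_assoc (star (word s _)),
    star_word_mul_word_of_length_eq hst.star_s_mul_s (by rw [w.1.2, w'.1.2])]
  by_cases h1 : w.1 = w'.1
  · rw [if_pos (by rw [h1]), one_mul,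
      star_word_mul_word_of_length_eq hst.star_t_mul_t (by rw [w.2.2, w'.2.2])]
    by_cases h2 : w.2 = w'.2
    · rw [if_pos (by rw [h2]), if_pos (Prod.ext h1 h2)]
    · rw [if_neg fun h => h2 (Subtype.ext h), if_neg fun h => h2 (congrArg Prod.snd h)]
  · rw [if_neg fun h => h1 (Subtype.ext h), if_neg fun h => h1 (congrArg Prod.fst h)]
    simp

/-- Monomials of degree zero map the isometries `s_κ t_l` to multiples of each other. -/
lemma monomial_mul_pairWord (hq : ‖q‖ = 1) {k : ℕ} {μ ν : List (Fin n)} {α β : List (Fin m)}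
    (hμν : μ.length = ν.length) (hαβ : α.length = β.length) (hν : ν.length ≤ k)
    (hβ : β.length ≤ k) (w : WordPair n m k) :
    ∃ (c : ℂ) (w' : WordPair n m k),
      monomial s t μ ν α β * pairWord s t w = c • pairWord s t w' := by
  obtain ⟨⟨κ, hκ⟩, ⟨l, hl⟩⟩ := w
  obtain ⟨c, hc⟩ := (qComm_starWords hst hq
    (mul_mem (word_mem_starWords t α) (star_word_mem_starWords t β))
    (word_mem_starWords s κ)).mul_mul_mul (word s μ * star (word s ν)) (word t l)
  have hc' : monomial s t μ ν α β * pairWord s t ((⟨κ, hκ⟩, ⟨l, hl⟩) : WordPair n m k) =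
      c • (word s μ * star (word s ν) * word s κ * (word t α * star (word t β) * word t l)) := hc
  rw [hc']
  rcases monomial_mul_word hst.star_s_mul_s hμν (a := κ) (by omega) with ⟨b, hb, h1⟩ | h1
  · rcases monomial_mul_word hst.star_t_mul_t hαβ (a := l) (by omega) with ⟨b', hb', h2⟩ | h2
    · exact ⟨c, (⟨b, by omega⟩, ⟨b', by omega⟩), by rw [h1, h2]; rfl⟩
    · exact ⟨0, (⟨κ, hκ⟩, ⟨l, hl⟩), by simp [h2]⟩
  · exact ⟨0, (⟨κ, hκ⟩, ⟨l, hl⟩), by simp [h1]⟩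

/-- Compression by suitable isometries kills the monomials of nonzero degree. -/
lemma star_pairWord_mul_monomial_mul_pairWord_eq_zero (hq : ‖q‖ = 1) {i j : Fin n} (hij : i ≠ j)
    {i' j' : Fin m} (hij' : i' ≠ j') {k : ℕ} {μ ν : List (Fin n)} {α β : List (Fin m)}
    (hμ : μ.length ≤ k) (hν : ν.length ≤ k) (hα : α.length ≤ k) (hβ : β.length ≤ k)
    (h : μ.length ≠ ν.length ∨ α.length ≠ β.length) (w w' : WordPair n m k) {f : A}
    (hf : f = word s (List.replicate k i ++ [j]) * word t (List.replicate k i' ++ [j'])) :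
    star (pairWord s t w * f) * monomial s t μ ν α β * (pairWord s t w' * f) = 0 := by
  have hcomm {a b : A} (ha : a ∈ starWords t) (hb : b ∈ starWords s) : QComm a b :=
    qComm_starWords hst hq ha hb
  have hws := word_mem_starWords s
  have hwt := word_mem_starWords t
  have hws' := star_word_mem_starWords s
  have hwt' := star_word_mem_starWords t
  -- Moving `t_l` past the `s`-word of `f` costs only a scalar, so each alphabet receives its own
  -- tail `i ⋯ i j`.
  have hsplit (w : WordPair n m k) : ∃ c : ℂ, pairWord s t w * f =
      c • (word s (w.1.1 ++ (List.replicate k i ++ [j])) *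
        word t (w.2.1 ++ (List.replicate k i' ++ [j']))) := by
    obtain ⟨c, hc⟩ := (hcomm (hwt w.2.1) (hws (List.replicate k i ++ [j]))).mul_mul_mul
      (word s w.1.1) (word t (List.replicate k i' ++ [j']))
    exact ⟨c, by rw [hf, word_append s w.1.1, word_append t w.2.1, ← hc, pairWord]⟩
  obtain ⟨c, hc⟩ := hsplit w
  obtain ⟨c', hc'⟩ := hsplit w'
  have hS := star_word_mul_monomial_mul_word_eq_zero hst.star_s_mul_s hij w.1.2 w'.1.2 hμ hν
  have hT := star_word_mul_monomial_mul_word_eq_zero hst.star_t_mul_t hij' w.2.2 w'.2.2 hα hβ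
  rw [hc, hc']
  generalize w.1.1 ++ (List.replicate k i ++ [j]) = a at *
  generalize w.2.1 ++ (List.replicate k i' ++ [j']) = b at *
  generalize w'.1.1 ++ (List.replicate k i ++ [j]) = a' at *
  generalize w'.2.1 ++ (List.replicate k i' ++ [j']) = b' at *
  obtain ⟨d, hd⟩ := (hcomm (mul_mem (hwt α) (hwt' β)) (hws a')).mul_mul_mul
    (word s μ * star (word s ν)) (word t b')
  obtain ⟨d', hd'⟩ := (hcomm (hwt' b) (mul_mem (mul_mem (hws' a) (mul_mem (hws μ) (hws' ν)))
    (hws a'))).mul_mul_mul 1 (word t α * star (word t β) * word t b')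
  -- Up to a scalar the compression factors into one for the `s`-part and one for the `t`-part; a
  -- nonzero degree in either alphabet makes it vanish.
  have key : star (word s a * word t b) * monomial s t μ ν α β * (word s a' * word t b') =
      (d * d') • (star (word s a) * (word s μ * star (word s ν)) * word s a' *
        (star (word t b) * (word t α * star (word t β)) * word t b')) := by
    rw [mul_assoc, monomial, hd, mul_smul_comm, star_mul, mul_smul]
    congr 1
    simp only [one_mul, mul_assoc] at hd' ⊢
    exact hd'
  rw [star_smul, smul_mul_assoc, smul_mul_assoc, mul_smul_comm, key]
  rcases h with h | h
  · rw [hS h]; simp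
  · rw [hT h]; simp

-- With `p_s` and `p_t` the sums for words of length `k` in each alphabet, the defect splits as `(1
-- - p_s) + ∑ s_v (1 - p_t) s_v⋆`.
omit hst in
lemma one_sub_sum_pairWord_mem {I : TwoSidedIdeal A} (hQ : 1 - ∑ j, s j * star (s j) ∈ I)
    (hP : 1 - ∑ r, t r * star (t r) ∈ I) (k : ℕ) :
    1 - ∑ w : WordPair n m k, pairWord s t w * star (pairWord s t w) ∈ I := by
  have h : 1 - ∑ w : WordPair n m k, pairWord s t w * star (pairWord s t w) =
      (1 - ∑ v : List.Vector (Fin n) k, word s v.1 * star (word s v.1)) +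
      ∑ v : List.Vector (Fin n) k, word s v.1 *
        (1 - ∑ u : List.Vector (Fin m) k, word t u.1 * star (word t u.1)) * star (word s v.1) := by
    rw [Fintype.sum_prod_type]
    simp only [mul_sub, sub_mul, mul_one, Finset.sum_sub_distrib, Finset.mul_sum, Finset.sum_mul,
      pairWord, star_mul, mul_assoc]
    abel
  rw [h]
  exact I.add_mem (one_sub_sum_word_mem hQ k) (sum_mem fun v _ =>
    I.mul_mem_right _ _ (I.mul_mem_left _ _ (one_sub_sum_word_mem hP k)))

/-- The span of the monomials is stable under left multiplication by letters and adjoints. -/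
lemma mul_mem_span_monomial (hq : ‖q‖ = 1) {a : A}
    (ha : a ∈ Set.range s ∪ Set.range t ∪ star (Set.range s ∪ Set.range t)) {b : A}
    (hb : b ∈ Submodule.span ℂ {x | ∃ μ ν α β, x = monomial s t μ ν α β}) :
    a * b ∈ Submodule.span ℂ {x | ∃ μ ν α β, x = monomial s t μ ν α β} := by
  have hmem (μ ν α β) : monomial s t μ ν α β ∈
      Submodule.span ℂ {x | ∃ μ ν α β, x = monomial s t μ ν α β} :=
    Submodule.subset_span ⟨μ, ν, α, β, rfl⟩
  induction hb using Submodule.span_induction with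
  | zero => simp
  | add x y _ _ hx hy => rw [mul_add]; exact add_mem hx hy
  | smul c x _ hx => rw [mul_smul_comm]; exact Submodule.smul_mem _ _ hx
  | mem x hx =>
    obtain ⟨μ, ν, α, β, rfl⟩ := hx
    have hpass (a : A) (ha : a ∈ starWords t) : ∃ c : ℂ, a * monomial s t μ ν α β =
        c • (word s μ * star (word s ν) * (a * (word t α * star (word t β)))) := by
      obtain ⟨c, hc⟩ := (qComm_starWords hst hq ha (mul_mem (word_mem_starWords s μ)
        (star_word_mem_starWords s ν))).mul_mul_mul 1 (word t α * star (word t β))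
      exact ⟨c, by simpa [monomial] using hc⟩
    rcases ha with (⟨i, rfl⟩ | ⟨r, rfl⟩) | (⟨i, hi⟩ | ⟨r, hr⟩)
    · convert hmem (i :: μ) ν α β using 1
      simp [monomial, mul_assoc]
    · obtain ⟨c, hc⟩ := hpass _ (letter_mem_starWords t r)
      rw [hc]
      refine Submodule.smul_mem _ _ ?_
      convert hmem μ ν (r :: α) β using 1
      simp [monomial, mul_assoc]
    · rw [← star_star a, ← hi, monomial, ← mul_assoc]
      rcases star_letter_mul_monomial hst.star_s_mul_s i μ ν with ⟨μ', ν', h⟩ | h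
      · rw [h]; exact hmem μ' ν' α β
      · rw [h]; simp
    · rw [← star_star a, ← hr]
      obtain ⟨c, hc⟩ := hpass _ (star_letter_mem_starWords t r)
      rw [hc]
      refine Submodule.smul_mem _ _ ?_
      rcases star_letter_mul_monomial hst.star_t_mul_t r α β with ⟨α', β', h⟩ | h
      · rw [h]; exact hmem μ ν α' β'
      · rw [h]; simp

/-- The span contains `1` and is stable under left multiplication by the generators and their
adjoints, so no formula for the product of two general monomials is required. -/
lemma adjoin_le_span_monomial (hq : ‖q‖ = 1) {a : A}
    (ha : a ∈ StarAlgebra.adjoin ℂ (Set.range s ∪ Set.range t)) :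
    a ∈ Submodule.span ℂ {x | ∃ μ ν α β, x = monomial s t μ ν α β} := by
  set N := Submodule.span ℂ {x | ∃ μ ν α β, x = monomial s t μ ν α β} with hN
  have h1 : (1 : A) ∈ N := Submodule.subset_span ⟨[], [], [], [], by simp [monomial]⟩
  have key : ∀ a ∈ Algebra.adjoin ℂ
      (Set.range s ∪ Set.range t ∪ star (Set.range s ∪ Set.range t)), ∀ b ∈ N, a * b ∈ N := by
    intro a ha
    induction ha using Algebra.adjoin_induction with
    | mem x hx => exact fun b hb => mul_mem_span_monomial hst hq hx hb
    | algebraMap r =>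
      intro b hb
      rw [← Algebra.smul_def]
      exact N.smul_mem r hb
    | add x y _ _ hx hy => exact fun b hb => by rw [add_mul]; exact add_mem (hx b hb) (hy b hb)
    | mul x y _ _ hx hy => exact fun b hb => by rw [mul_assoc]; exact hx _ (hy b hb)
  have ha' : a ∈ (StarAlgebra.adjoin ℂ (Set.range s ∪ Set.range t)).toSubalgebra := ha
  rw [StarAlgebra.adjoin_toSubalgebra] at ha'
  simpa using key a ha' 1 h1

end Family

/-- The monomials with words of length at most `K`. -/
def boundedMonomials {n m : ℕ} {A : Type*} [CStarAlgebra A] (s : Fin n → A) (t : Fin m → A)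
    (K : ℕ) : Set A :=
  {x | ∃ μ ν α β, μ.length ≤ K ∧ ν.length ≤ K ∧ α.length ≤ K ∧ β.length ≤ K ∧
    x = monomial s t μ ν α β}

lemma exists_mem_span_boundedMonomials {n m : ℕ} {A : Type*} [CStarAlgebra A] {s : Fin n → A}
    {t : Fin m → A} {a : A}
    (ha : a ∈ Submodule.span ℂ {x | ∃ μ ν α β, x = monomial s t μ ν α β}) :
    ∃ K, a ∈ Submodule.span ℂ (boundedMonomials s t K) := by
  have hmono : ∀ {K L}, K ≤ L → Submodule.span ℂ (boundedMonomials s t K) ≤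
      Submodule.span ℂ (boundedMonomials s t L) := by
    intro K L h
    refine Submodule.span_mono ?_
    rintro x ⟨μ, ν, α, β, h1, h2, h3, h4, rfl⟩
    exact ⟨μ, ν, α, β, by omega, by omega, by omega, by omega, rfl⟩
  induction ha using Submodule.span_induction with
  | zero => exact ⟨0, zero_mem _⟩
  | add x y _ _ hx hy =>
    obtain ⟨K, hK⟩ := hx
    obtain ⟨L, hL⟩ := hy
    exact ⟨max K L, add_mem (hmono (le_max_left _ _) hK) (hmono (le_max_right _ _) hL)⟩
  | smul c x _ hx => exact ⟨hx.choose, Submodule.smul_mem _ _ hx.choose_spec⟩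
  | mem x hx =>
    obtain ⟨μ, ν, α, β, rfl⟩ := hx
    exact ⟨μ.length + ν.length + α.length + β.length, Submodule.subset_span
      ⟨μ, ν, α, β, by omega, by omega, by omega, by omega, rfl⟩⟩

/-- Elements of `𝓔^q_{n,m}` are approximated by linear combinations of monomials. -/
lemma exists_norm_sub_lt_mem_span_boundedMonomials {q : ℂ} (hq : ‖q‖ = 1) {n m : ℕ} (a : E q n m)
    {ε : ℝ} (hε : 0 < ε) : ∃ K, ∃ p ∈ Submodule.span ℂ
      (boundedMonomials (sGen q n m) (tGen q n m) K), ‖a - p‖ < ε := by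
  have ha : a ∈ generated (gen q n m) := generated_gen_eq_top q n m ▸ StarSubalgebra.mem_top
  obtain ⟨p, hp, hap⟩ := Metric.mem_closure_iff.1 ha ε hε
  have hr : Set.range (gen q n m) = Set.range (sGen q n m) ∪ Set.range (tGen q n m) := by
    rw [← Set.Sum.elim_range]
    congr 1
    ext x
    rcases x with i | r <;> rfl
  rw [hr] at hp
  obtain ⟨K, hK⟩ := exists_mem_span_boundedMonomials
    (adjoin_le_span_monomial (isQFamily_sGen_tGen q n m) hq hp)
  exact ⟨K, p, hK, by rwa [← dist_eq_norm]⟩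

/-! ### Isometric copies of matrix algebras -/

section Matrix

open scoped Matrix.Norms.L2Operator

variable {A : Type*} [CStarAlgebra A] {W : Type*} [Fintype W] [DecidableEq W] {V : W → A}
  (hV : ∀ w w', star (V w) * V w' = if w = w' then 1 else 0)

/-- The *-homomorphism `C ↦ ∑ C w w' V w (V w')⋆` for isometries `V` with orthogonal ranges. -/
def matrixHom : Matrix W W ℂ →⋆ₙₐ[ℂ] A where
  toFun C := ∑ w, ∑ w', C w w' • (V w * star (V w'))
  map_smul' c C := by simp [Finset.smul_sum, smul_smul]
  map_zero' := by simp
  map_add' C D := by simp [add_smul, Finset.sum_add_distrib]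
  map_mul' C D := by
    have h (w w' v v' : W) : V w * star (V w') * (V v * star (V v')) =
        if w' = v then V w * star (V v') else 0 := by
      rw [mul_assoc, ← mul_assoc (star (V w')), hV]
      split_ifs <;> simp
    have h2 (w w' : W) : C w w' • (V w * star (V w')) * ∑ v, ∑ v', D v v' • (V v * star (V v')) =
        ∑ v', (C w w' * D w' v') • (V w * star (V v')) := by
      simp only [Finset.mul_sum, smul_mul_assoc, mul_smul_comm, h]
      rw [Finset.sum_comm]
      simp [smul_smul, mul_comm]
    simp only [Finset.sum_mul, h2, Matrix.mul_apply, Finset.sum_smul]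
    exact Finset.sum_congr rfl fun w _ => Finset.sum_comm
  map_star' C := by
    simp only [star_sum, star_smul, star_mul, star_star, Matrix.star_apply]
    exact Finset.sum_comm

lemma matrixHom_apply (C : Matrix W W ℂ) :
    matrixHom hV C = ∑ w, ∑ w', C w w' • (V w * star (V w')) := rfl

include hV

lemma star_sum_smul_mul_sum_smul (u v : W → ℂ) :
    star (∑ w, u w • V w) * ∑ w, v w • V w = (∑ w, star (u w) * v w) • (1 : A) := by
  simp only [star_sum, star_smul, Finset.sum_mul, Finset.mul_sum, smul_mul_assoc, mul_smul_comm,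
    hV, smul_ite, smul_zero, Finset.sum_ite_eq', Finset.mem_univ, if_true, Finset.sum_smul,
    smul_smul]
  simp [mul_comm]

lemma norm_sum_smul_le [Nontrivial A] (u : EuclideanSpace ℂ W) : ‖∑ w, u w • V w‖ ≤ ‖u‖ := by
  have h := CStarRing.norm_star_mul_self (x := ∑ w, u w • V w)
  rw [star_sum_smul_mul_sum_smul hV, norm_smul, CStarRing.norm_one, mul_one] at h
  have h2 : ∑ w, star (u w) * u w = ((‖u‖ ^ 2 : ℝ) : ℂ) := by
    rw [EuclideanSpace.norm_sq_eq]
    push_cast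
    exact Finset.sum_congr rfl fun w _ => Complex.conj_mul' (u w)
  rw [h2, Complex.norm_real, Real.norm_of_nonneg (by positivity)] at h
  nlinarith [norm_nonneg u, norm_nonneg (∑ w, u w • V w)]

lemma matrixHom_mul_sum_smul (C : Matrix W W ℂ) (u : W → ℂ) :
    matrixHom hV C * ∑ w, u w • V w = ∑ w, C.mulVec u w • V w := by
  simp only [matrixHom_apply, Finset.sum_mul, Finset.mul_sum, smul_mul_assoc, mul_smul_comm,
    mul_assoc, hV, mul_ite, mul_one, mul_zero, smul_ite, smul_zero,
    Finset.sum_ite_eq', Finset.mem_univ, if_true, Matrix.mulVec, dotProduct, Finset.sum_smul,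
    Finset.smul_sum, smul_smul]
  rw [Finset.sum_comm]
  simp only [mul_comm]

lemma matrixHom_one_mul {a : A} (ha : a ∈ Submodule.span ℂ (Set.range V)) :
    matrixHom hV 1 * a = a := by
  induction ha using Submodule.span_induction with
  | zero => simp
  | add x y _ _ hx hy => rw [mul_add, hx, hy]
  | smul c x _ hx => rw [mul_smul_comm, hx]
  | mem x hx =>
    obtain ⟨w, rfl⟩ := hx
    simpa [Pi.single_apply, Matrix.one_apply] using matrixHom_mul_sum_smul hV 1 (Pi.single w 1)

lemma matrixHom_one : matrixHom hV 1 = ∑ w, V w * star (V w) := by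
  simp [matrixHom_apply, Matrix.one_apply]

lemma mul_matrixHom_one (a : A) : a * matrixHom hV 1 = ∑ w, a * (V w * star (V w)) := by
  rw [matrixHom_one, Finset.mul_sum]

lemma matrixHom_single (w w' : W) (c : ℂ) :
    matrixHom hV (Matrix.single w w' c) = c • (V w * star (V w')) := by
  rw [matrixHom_apply, Finset.sum_eq_single w, Finset.sum_eq_single w']
  · simp
  · intro v _ hv
    simp [hv.symm]
  · simp
  · intro v _ hv
    simp [hv.symm]
  · simp

lemma norm_matrixHom_one_le : ‖matrixHom hV 1‖ ≤ 1 := by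
  have h := CStarRing.norm_star_mul_self (x := matrixHom hV 1)
  rw [← map_star, ← map_mul, star_one, one_mul] at h
  nlinarith [norm_nonneg (matrixHom hV 1)]

/-- The norm of a matrix is attained by compressions to scalars. -/
lemma exists_star_mul_matrixHom_mul_eq_smul_one [Nontrivial A] (C : Matrix W W ℂ) {τ : ℝ}
    (hτ : 0 ≤ τ) (hC : τ < ‖matrixHom hV C‖) :
    ∃ a ∈ Submodule.span ℂ (Set.range V), ∃ b ∈ Submodule.span ℂ (Set.range V),
      ‖a‖ ≤ 1 ∧ ‖b‖ ≤ 1 ∧ ∃ c : ℂ, τ < ‖c‖ ∧ star a * matrixHom hV C * b = c • 1 := by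
  have hmem (u : W → ℂ) : ∑ w, u w • V w ∈ Submodule.span ℂ (Set.range V) :=
    sum_mem fun w _ => Submodule.smul_mem _ _ (Submodule.subset_span ⟨w, rfl⟩)
  -- A *-homomorphism is contractive, so the operator norm of `C` exceeds `τ` and some `ξ` in the
  -- unit ball has `‖Cξ‖ > τ`.
  have h1 : τ < ‖C‖ := hC.trans_le (NonUnitalStarAlgHom.norm_apply_le (matrixHom hV) C)
  rw [Matrix.l2_opNorm_def] at h1
  obtain ⟨ξ, hξ, h2⟩ := ContinuousLinearMap.exists_lt_apply_of_lt_opNorm _ h1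
  set u : EuclideanSpace ℂ W := Matrix.toEuclideanLin C ξ with hu
  have h2' : τ < ‖u‖ := h2
  have hu0 : 0 < ‖u‖ := hτ.trans_lt h2'
  have hCu : C.mulVec ξ = u := rfl
  have h3 : ∑ w, star (u w) * u w = ((‖u‖ ^ 2 : ℝ) : ℂ) := by
    rw [EuclideanSpace.norm_sq_eq]
    push_cast
    exact Finset.sum_congr rfl fun w _ => Complex.conj_mul' (u w)
  -- Here `b` encodes `ξ` and `a` encodes `Cξ / ‖Cξ‖`, so the resulting scalar is `⟨Cξ / ‖Cξ‖, Cξ⟩ =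
  -- ‖Cξ‖`.
  refine ⟨((‖u‖⁻¹ : ℝ) : ℂ) • ∑ w, u w • V w, Submodule.smul_mem _ _ (hmem _), ∑ w, ξ w • V w,
    hmem _, ?_, (norm_sum_smul_le hV ξ).trans hξ.le, ((‖u‖ : ℝ) : ℂ), ?_, ?_⟩
  · rw [norm_smul, Complex.norm_real, norm_inv, norm_norm]
    exact inv_mul_le_one_of_le₀ (norm_sum_smul_le hV u) (norm_nonneg _)
  · simpa using h2'
  · rw [mul_assoc, matrixHom_mul_sum_smul hV, hCu, star_smul, smul_mul_assoc,
      star_sum_smul_mul_sum_smul hV, h3, smul_smul]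
    congr 1
    have : ((‖u‖ : ℝ) : ℂ) ≠ 0 := by exact_mod_cast hu0.ne'
    simp
    field_simp

end Matrix

/-! ### Sums of positive elements -/

/-- Discarding positive summands cannot increase the norm; this is how points of the torus far from
the identity are dropped from an average. -/
lemma norm_sum_star_mul_self_le {A : Type*} [CStarAlgebra A] {ι : Type*} {s t : Finset ι}
    (h : s ⊆ t) (a : ι → A) : ‖∑ i ∈ s, star (a i) * a i‖ ≤ ‖∑ i ∈ t, star (a i) * a i‖ := by
  let := CStarAlgebra.spectralOrder A
  have := CStarAlgebra.spectralOrderedRing A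
  refine CStarAlgebra.norm_le_norm_of_nonneg_of_le
    (Finset.sum_nonneg fun i _ => star_mul_self_nonneg _) ?_
  exact Finset.sum_le_sum_of_subset_of_nonneg h fun i _ _ => star_mul_self_nonneg _

/-- An element near a nonzero scalar lies in no proper ideal. -/
lemma eq_top_of_norm_sub_smul_one_lt {A : Type*} [CStarAlgebra A] {J : TwoSidedIdeal A} {a : A}
    (ha : a ∈ J) {c : ℂ} (h : ‖a - c • 1‖ < ‖c‖) : J = ⊤ := by
  have hc : c ≠ 0 := by
    rintro rfl
    simp only [norm_zero] at h
    exact absurd h (norm_nonneg _).not_gt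
  have h1 : ‖1 - c⁻¹ • a‖ < 1 := by
    have : 1 - c⁻¹ • a = -(c⁻¹ • (a - c • 1)) := by
      rw [smul_sub, smul_smul, inv_mul_cancel₀ hc, one_smul, neg_sub]
    rw [this, norm_neg, norm_smul, norm_inv]
    rwa [inv_mul_lt_one₀ (norm_pos_iff.2 hc)]
  have h2 : IsUnit (c⁻¹ • a) := by
    have := isUnit_one_sub_of_norm_lt_one h1
    rwa [sub_sub_cancel] at this
  obtain ⟨u, hu⟩ := h2
  have h3 : (u : A) ∈ J := by
    rw [hu, ← one_mul a, ← smul_mul_assoc]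
    exact J.mul_mem_left _ _ ha
  rw [eq_top_iff]
  intro x _
  rw [← mul_one x, ← u.inv_mul]
  exact J.mul_mem_left _ _ (J.mul_mem_left _ _ h3)

/-! ### The gauge action and its averages -/

section Gauge

variable (q : ℂ) (n m : ℕ)

/-- Working in the continuous functions on the torus, one application of the universal property
yields all gauge endomorphisms together with their continuity in the parameter. -/
lemma isQFamily_gauge : IsQFamily q (A := C(Circle × Circle, E q n m))
    (fun i => ⟨fun z => (z.1 : ℂ) • sGen q n m i, by fun_prop⟩)
    (fun r => ⟨fun z => (z.2 : ℂ) • tGen q n m r, by fun_prop⟩) := by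
  have h := isQFamily_sGen_tGen q n m
  have hz (z : Circle) : (z : ℂ) * (starRingEnd ℂ) z = 1 := by
    rw [Complex.mul_conj', Circle.norm_coe]
    simp
  refine ⟨fun i j => ?_, fun i j => ?_, fun i j => ?_⟩ <;> ext z
  · have := h.star_s_mul_s i j
    split_ifs with hij <;> simp_all [smul_smul]
  · have := h.star_t_mul_t i j
    split_ifs with hij <;> simp_all [smul_smul]
  · have := h.star_s_mul_t i j
    simp [this, smul_smul]
    ring_nf

/-- The gauge action of the torus, as a *-homomorphism into the continuous functions on it. -/
def gauge : E q n m →⋆ₐ[ℂ] C(Circle × Circle, E q n m) :=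
  (existsUnique_lift (isQFamily_gauge q n m)).choose

variable {q n m}

/-- The gauge automorphism of a point of the torus. -/
def gaugeAt (z : Circle × Circle) : E q n m →⋆ₐ[ℂ] E q n m where
  toFun a := gauge q n m a z
  map_one' := by rw [map_one]; rfl
  map_mul' _ _ := by rw [map_mul]; rfl
  map_zero' := by rw [map_zero]; rfl
  map_add' _ _ := by rw [map_add]; rfl
  commutes' c := by rw [AlgHomClass.commutes]; rfl
  map_star' a := by rw [map_star]; rfl

lemma gaugeAt_sGen (z : Circle × Circle) (i : Fin n) :
    gaugeAt z (sGen q n m i) = (z.1 : ℂ) • sGen q n m i :=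
  DFunLike.congr_fun ((existsUnique_lift (isQFamily_gauge q n m)).choose_spec.1.1 i) z

lemma gaugeAt_tGen (z : Circle × Circle) (r : Fin m) :
    gaugeAt z (tGen q n m r) = (z.2 : ℂ) • tGen q n m r :=
  DFunLike.congr_fun ((existsUnique_lift (isQFamily_gauge q n m)).choose_spec.1.2 r) z

lemma gaugeAt_one : gaugeAt (1 : Circle × Circle) = StarAlgHom.id ℂ (E q n m) :=
  (existsUnique_lift (isQFamily_sGen_tGen q n m)).unique
    ⟨fun i => by simp [gaugeAt_sGen], fun r => by simp [gaugeAt_tGen]⟩ ⟨fun _ => rfl, fun _ => rfl⟩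

lemma continuous_gaugeAt (a : E q n m) : Continuous fun z => gaugeAt z a :=
  (gauge q n m a).continuous

lemma gaugeAt_word {k : ℕ} {x : Fin k → E q n m} {z : Circle × Circle} {c : ℂ}
    (h : ∀ i, gaugeAt z (x i) = c • x i) (l : List (Fin k)) :
    gaugeAt z (word x l) = c ^ l.length • word x l := by
  induction l with
  | nil => simp
  | cons i l ih => rw [word_cons, map_mul, h, ih]; simp [smul_smul, pow_succ]

lemma gaugeAt_monomial (z : Circle × Circle) (μ ν : List (Fin n)) (α β : List (Fin m)) :
    gaugeAt z (monomial (sGen q n m) (tGen q n m) μ ν α β) =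
      (((z.1 : ℂ) ^ μ.length * star (z.1 : ℂ) ^ ν.length) *
        ((z.2 : ℂ) ^ α.length * star (z.2 : ℂ) ^ β.length)) •
      monomial (sGen q n m) (tGen q n m) μ ν α β := by
  have hstar (a : E q n m) : gaugeAt z (star a) = star (gaugeAt z a) := map_star _ _
  simp only [monomial, map_mul, hstar, gaugeAt_word (gaugeAt_sGen z),
    gaugeAt_word (gaugeAt_tGen z), star_smul, smul_mul_assoc, mul_smul_comm, smul_smul, star_pow]
  congr 1
  ring

/-- The standard primitive root of unity. -/
def unityRoot (M : ℕ) : Circle := Circle.exp (2 * Real.pi / M)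

/-- Orthogonality of characters of the `M`-th roots of unity; the bounds on `a` and `b` rule out
distinct exponents congruent modulo `M`. -/
lemma sum_unityRoot {M a b : ℕ} (ha : a < M) (hb : b < M) :
    ∑ i ∈ Finset.range M, (((unityRoot M ^ i : Circle) : ℂ) ^ a *
      star ((unityRoot M ^ i : Circle) : ℂ) ^ b) = if a = b then (M : ℂ) else 0 := by
  have hM : M ≠ 0 := by omega
  set ζ : ℂ := (unityRoot M : ℂ) with hζ
  have hprim : IsPrimitiveRoot ζ M := by
    convert Complex.isPrimitiveRoot_exp M hM using 1
    rw [hζ, unityRoot, Circle.coe_exp]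
    congr 1
    push_cast
    ring
  have hζζ : ζ * star ζ = 1 := by
    have := Complex.mul_conj' ζ
    rw [hζ, Circle.norm_coe] at this
    simpa using this
  set w : ℂ := ζ ^ a * star ζ ^ b with hw
  have hwM : w ^ M = 1 := by
    rw [hw, mul_pow, ← pow_mul, ← pow_mul, mul_comm a, mul_comm b, pow_mul, pow_mul,
      ← star_pow, hprim.pow_eq_one]
    simp
  have hsum : ∑ i ∈ Finset.range M, (((unityRoot M ^ i : Circle) : ℂ) ^ a *
      star ((unityRoot M ^ i : Circle) : ℂ) ^ b) = ∑ i ∈ Finset.range M, w ^ i := by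
    refine Finset.sum_congr rfl fun i _ => ?_
    rw [Circle.coe_pow, ← hζ, star_pow, hw, mul_pow]
    simp only [← pow_mul, mul_comm i]
  rw [hsum]
  split_ifs with h
  · subst h
    have : w = 1 := by rw [hw, ← mul_pow, hζζ, one_pow]
    simp [this]
  · have hw1 : w ≠ 1 := by
      intro h1
      refine h (hprim.pow_inj ha hb ?_)
      calc ζ ^ a = ζ ^ a * (ζ * star ζ) ^ b := by rw [hζζ, one_pow, mul_one]
        _ = w * ζ ^ b := by rw [hw, mul_pow]; ring
        _ = ζ ^ b := by rw [h1, one_mul]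
    have := geom_sum_mul w M
    rw [hwM, sub_self] at this
    exact (mul_eq_zero.1 this).resolve_right (sub_ne_zero.2 hw1)

end Gauge

section Average

variable {A : Type*} [CStarAlgebra A] (g : Circle × Circle → A →⋆ₐ[ℂ] A)

/-- The average of an action of the torus over the points of order dividing `M`. -/
def torusAverage (M : ℕ) : A →ₗ[ℂ] A :=
  ((M : ℂ) ^ 2)⁻¹ • ∑ p ∈ Finset.range M ×ˢ Finset.range M,
    (g (unityRoot M ^ p.1, unityRoot M ^ p.2)).toAlgHom.toLinearMap

lemma torusAverage_apply (M : ℕ) (a : A) : torusAverage g M a =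
    ((M : ℂ) ^ 2)⁻¹ • ∑ p ∈ Finset.range M ×ˢ Finset.range M,
      g (unityRoot M ^ p.1, unityRoot M ^ p.2) a := by
  simp [torusAverage]

lemma norm_torusAverage_le (M : ℕ) (a : A) : ‖torusAverage g M a‖ ≤ ‖a‖ := by
  rcases Nat.eq_zero_or_pos M with rfl | hM
  · simp [torusAverage_apply]
  · have h : ‖∑ p ∈ Finset.range M ×ˢ Finset.range M,
        g (unityRoot M ^ p.1, unityRoot M ^ p.2) a‖ ≤ (M : ℝ) ^ 2 * ‖a‖ := by
      refine (norm_sum_le_of_le _ fun p _ => NonUnitalStarAlgHom.norm_apply_le (g _) a).trans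
        (le_of_eq ?_)
      simp [pow_two]
    have hM' : (0 : ℝ) < (M : ℝ) ^ 2 := by positivity
    rw [torusAverage_apply, norm_smul, norm_inv, norm_pow, Complex.norm_natCast,
      inv_mul_le_iff₀ hM']
    exact h

lemma torusAverage_eq_smul {M : ℕ} {a : A} {c d : Circle → ℂ}
    (h : ∀ z, g z a = (c z.1 * d z.2) • a) : torusAverage g M a =
      (((M : ℂ) ^ 2)⁻¹ * ((∑ i ∈ Finset.range M, c (unityRoot M ^ i)) *
        ∑ i ∈ Finset.range M, d (unityRoot M ^ i))) • a := by
  rw [torusAverage_apply, Finset.sum_mul_sum, ← Finset.sum_product', mul_smul, Finset.sum_smul]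
  simp only [h]

/-- Averaging over an action of the torus is uniformly bounded below on a positive element. -/
lemma exists_norm_le_norm_torusAverage (hcont : ∀ a, Continuous fun z => g z a)
    (hone : g 1 = StarAlgHom.id ℂ A) (x : A) {ε : ℝ} (hε : 0 < ε) :
    ∃ r : ℕ, 0 < r ∧ ∀ L : ℕ, 0 < L → ∀ R : A, star R = R → ‖R‖ ≤ 1 →
      ‖R * (star x * x) * R‖ - ε ≤ (r : ℝ) ^ 2 * ‖R * torusAverage g (r * L) (star x * x) * R‖ := by
  set y := star x * x with hy
  have hcont' : Continuous fun p : ℝ × ℝ =>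
      g (Circle.exp (2 * Real.pi * p.1), Circle.exp (2 * Real.pi * p.2)) y :=
    (hcont y).comp (by fun_prop)
  obtain ⟨ρ, hρ, hball⟩ := Metric.continuous_iff.1 hcont' 0 ε hε
  obtain ⟨r', hr'⟩ := exists_nat_one_div_lt hρ
  -- With `1 / r < ρ`, the first `L` of the `M = r * L` roots in each coordinate are near `1`: a
  -- proportion `1 / r²` of the torus points, whatever `L` is. Thus `r` depends only on `x` and `ε`.
  refine ⟨r' + 1, r'.succ_pos, fun L hL R hR hR1 => ?_⟩
  set r := r' + 1 with hr
  have hr0 : (0 : ℝ) < r := by positivity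
  have hL0 : (0 : ℝ) < L := by exact_mod_cast hL
  set M := r * L with hM
  have hM0 : (0 : ℝ) < M := by rw [hM]; push_cast; positivity
  let u : ℕ × ℕ → Circle × Circle := fun p => (unityRoot M ^ p.1, unityRoot M ^ p.2)
  have hroot (i : ℕ) : unityRoot M ^ i = Circle.exp (2 * Real.pi * (i / M)) := by
    rw [unityRoot, ← Circle.exp_nsmul]
    congr 1
    rw [nsmul_eq_mul]
    ring
  have hsmall (i : ℕ) (hi : i < L) : |(i / M : ℝ)| < ρ := by
    rw [abs_of_nonneg (by positivity)]
    refine lt_of_lt_of_le ?_ hr'.le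
    have : (i : ℝ) < L := by exact_mod_cast hi
    rw [div_lt_div_iff₀ hM0 (by positivity), hM, hr]
    push_cast
    nlinarith
  have hnear : ∀ p ∈ Finset.range L ×ˢ Finset.range L, ‖g (u p) y - y‖ ≤ ε := by
    rintro ⟨i, j⟩ hp
    rw [Finset.mem_product, Finset.mem_range, Finset.mem_range] at hp
    have h := hball ((i / M : ℝ), (j / M : ℝ)) (by
      rw [Prod.dist_eq, max_lt_iff]
      simp only [Prod.fst_zero, Prod.snd_zero, dist_zero_right, Real.norm_eq_abs]
      exact ⟨hsmall i hp.1, hsmall j hp.2⟩)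
    have h1 : ((1 : Circle), (1 : Circle)) = 1 := rfl
    simp only [Prod.fst_zero, Prod.snd_zero, mul_zero, Circle.exp_zero, h1, hone,
      dist_eq_norm] at h
    simp only [u, hroot]
    exact h.le
  -- Each term is positive, so restricting the average to the points near the identity bounds it
  -- from below.
  have hsq (p : ℕ × ℕ) : R * g (u p) y * R =
      star (g (u p) x * R) * (g (u p) x * R) := by
    have : g (u p) (star x) = star (g (u p) x) := map_star _ _
    rw [hy, map_mul, this, star_mul, hR]
    simp only [mul_assoc]
  have hsub : Finset.range L ×ˢ Finset.range L ⊆ Finset.range M ×ˢ Finset.range M := by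
    have : L ≤ M := Nat.le_mul_of_pos_left L r'.succ_pos
    exact Finset.product_subset_product (Finset.range_subset_range.2 this)
      (Finset.range_subset_range.2 this)
  have hmono := norm_sum_star_mul_self_le hsub fun p => g (u p) x * R
  simp only [← hsq] at hmono
  have hlow : (L : ℝ) ^ 2 * (‖R * y * R‖ - ε) ≤
      ‖∑ p ∈ Finset.range L ×ˢ Finset.range L, R * g (u p) y * R‖ := by
    have h1 : ∑ p ∈ Finset.range L ×ˢ Finset.range L, R * g (u p) y * R =
        (L : ℂ) ^ 2 • (R * y * R) +
        ∑ p ∈ Finset.range L ×ˢ Finset.range L, R * (g (u p) y - y) * R := by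
      simp only [mul_sub, sub_mul, Finset.sum_sub_distrib, Finset.sum_const, Finset.card_product,
        Finset.card_range]
      rw [← Nat.cast_smul_eq_nsmul ℂ]
      push_cast
      rw [pow_two]
      abel
    have h2 : ‖∑ p ∈ Finset.range L ×ˢ Finset.range L, R * (g (u p) y - y) * R‖ ≤
        (L : ℝ) ^ 2 * ε := by
      refine (norm_sum_le_of_le (f := fun _ => R * _ * R) (n := fun _ => ε) _ fun p hp => ?_).trans
        (le_of_eq (by simp [pow_two]))
      calc ‖R * (g (u p) y - y) * R‖ ≤ ‖R‖ * ‖g (u p) y - y‖ * ‖R‖ := norm_mul₃_le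
        _ ≤ 1 * ε * 1 := by
          gcongr
          exact hnear p hp
        _ = ε := by ring
    have h3 : ‖(L : ℂ) ^ 2 • (R * y * R)‖ = (L : ℝ) ^ 2 * ‖R * y * R‖ := by
      rw [norm_smul, norm_pow, Complex.norm_natCast]
    have h4 := norm_sub_le_norm_add ((L : ℂ) ^ 2 • (R * y * R))
      (∑ p ∈ Finset.range L ×ˢ Finset.range L, R * (g (u p) y - y) * R)
    rw [h1]
    linarith
  have havg : ‖R * torusAverage g M y * R‖ = ((M : ℝ) ^ 2)⁻¹ *
      ‖∑ p ∈ Finset.range M ×ˢ Finset.range M, R * g (u p) y * R‖ := by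
    rw [torusAverage_apply, mul_smul_comm, smul_mul_assoc, Finset.mul_sum, Finset.sum_mul,
      norm_smul, norm_inv, norm_pow, Complex.norm_natCast]
  have hfinal := hlow.trans hmono
  have hscale (X : ℝ) : (r : ℝ) ^ 2 * (((M : ℝ) ^ 2)⁻¹ * X) = ((L : ℝ) ^ 2)⁻¹ * X := by
    rw [hM]
    push_cast
    field_simp
  rw [havg, hscale, le_inv_mul_iff₀ (by positivity)]
  exact hfinal


end Average

section Gauge

variable {q : ℂ} {n m : ℕ}

/-- The average of the gauge action over the points of order dividing `M`. -/
def gaugeAverage (M : ℕ) : E q n m →ₗ[ℂ] E q n m := torusAverage gaugeAt M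

/-- Once `M` exceeds all word lengths, the finite average acts on these monomials exactly as the
projection onto degree zero. -/
lemma gaugeAverage_monomial {M : ℕ} {μ ν : List (Fin n)} {α β : List (Fin m)}
    (hμ : μ.length < M) (hν : ν.length < M) (hα : α.length < M) (hβ : β.length < M) :
    gaugeAverage M (monomial (sGen q n m) (tGen q n m) μ ν α β) =
      if μ.length = ν.length ∧ α.length = β.length then
        monomial (sGen q n m) (tGen q n m) μ ν α β else 0 := by
  have hM : (M : ℂ) ≠ 0 := by
    have : M ≠ 0 := by omega
    exact_mod_cast this
  rw [gaugeAverage, torusAverage_eq_smul (gaugeAt (q := q) (n := n) (m := m))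
    (c := fun z => (z : ℂ) ^ μ.length * star (z : ℂ) ^ ν.length)
    (d := fun z => (z : ℂ) ^ α.length * star (z : ℂ) ^ β.length)
    (fun z => gaugeAt_monomial z μ ν α β), sum_unityRoot hμ hν, sum_unityRoot hα hβ]
  by_cases h1 : μ.length = ν.length <;> by_cases h2 : α.length = β.length <;> simp [h1, h2]
  field_simp
  simp

end Gauge

/-! ### Compression to scalars and maximality of `𝓜_q` -/

section Main

variable {q : ℂ} {n m : ℕ}

lemma star_pairWord_sGen_mul {k : ℕ} (w w' : WordPair n m k) :
    star (pairWord (sGen q n m) (tGen q n m) w) * pairWord (sGen q n m) (tGen q n m) w' =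
      if w = w' then 1 else 0 :=
  star_pairWord_mul_pairWord (isQFamily_sGen_tGen q n m) w w'

/-- Averages of polynomials are matrices. -/
lemma exists_gaugeAverage_mul_eq_matrixHom (hq : ‖q‖ = 1) {K M : ℕ} (hM : K < M) {p : E q n m}
    (hp : p ∈ Submodule.span ℂ (boundedMonomials (sGen q n m) (tGen q n m) K)) :
    ∃ C : Matrix (WordPair n m K) (WordPair n m K) ℂ,
      gaugeAverage M p * matrixHom star_pairWord_sGen_mul (1 : Matrix (WordPair n m K) _ ℂ) =
        matrixHom star_pairWord_sGen_mul C := by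
  induction hp using Submodule.span_induction with
  | zero => exact ⟨0, by simp⟩
  | add x y _ _ hx hy =>
    obtain ⟨C, hC⟩ := hx
    obtain ⟨D, hD⟩ := hy
    exact ⟨C + D, by rw [map_add, add_mul, hC, hD, map_add]⟩
  | smul c x _ hx =>
    obtain ⟨C, hC⟩ := hx
    exact ⟨c • C, by rw [map_smul, smul_mul_assoc, hC, map_smul]⟩
  | mem x hx =>
    obtain ⟨μ, ν, α, β, hμ, hν, hα, hβ, rfl⟩ := hx
    rw [gaugeAverage_monomial (by omega) (by omega) (by omega) (by omega)]
    split_ifs with h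
    · choose c v hcv using monomial_mul_pairWord (isQFamily_sGen_tGen q n m) hq h.1 h.2 hν hβ
      -- The monomial sends `V_w` to `c w • V_(v w)`, so column `w` has its only possibly nonzero
      -- entry in row `v w`.
      refine ⟨∑ w, Matrix.single (v w) w (c w), ?_⟩
      rw [mul_matrixHom_one, map_sum]
      refine Finset.sum_congr rfl fun w _ => ?_
      rw [matrixHom_single, ← mul_assoc, hcv, smul_mul_assoc]
    · exact ⟨0, by simp⟩

/-- Compressions by suitable isometries see only the averages of polynomials. -/
lemma compression_eq_compression_gaugeAverage (hq : ‖q‖ = 1) {i j : Fin n} (hij : i ≠ j)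
    {i' j' : Fin m} (hij' : i' ≠ j') {K M : ℕ} (hM : K < M) {p f a b : E q n m}
    (hp : p ∈ Submodule.span ℂ (boundedMonomials (sGen q n m) (tGen q n m) K))
    (hf : f = word (sGen q n m) (List.replicate K i ++ [j]) *
      word (tGen q n m) (List.replicate K i' ++ [j']))
    (ha : a ∈ Submodule.span ℂ
      (Set.range (pairWord (k := K) (sGen q n m) (tGen q n m))))
    (hb : b ∈ Submodule.span ℂ
      (Set.range (pairWord (k := K) (sGen q n m) (tGen q n m)))) :
    star (a * f) * p * (b * f) = star (a * f) * gaugeAverage M p * (b * f) := by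
  induction ha using Submodule.span_induction with
  | zero => simp
  | add x y _ _ hx hy => simp only [add_mul, star_add, hx, hy]
  | smul c x _ hx => simp only [smul_mul_assoc, star_smul, hx]
  | mem a ha =>
    obtain ⟨w, rfl⟩ := ha
    induction hb using Submodule.span_induction with
    | zero => simp
    | add x y _ _ hx hy => simp only [add_mul, mul_add, hx, hy]
    | smul c x _ hx => simp only [smul_mul_assoc, mul_smul_comm, hx]
    | mem b hb =>
      obtain ⟨w', rfl⟩ := hb
      induction hp using Submodule.span_induction with
      | zero => simp
      | add x y _ _ hx hy => simp only [add_mul, mul_add, map_add, hx, hy]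
      | smul c x _ hx => simp only [smul_mul_assoc, mul_smul_comm, map_smul, hx]
      | mem x hx =>
        obtain ⟨μ, ν, α, β, hμ, hν, hα, hβ, rfl⟩ := hx
        rw [gaugeAverage_monomial (by omega) (by omega) (by omega) (by omega)]
        split_ifs with h
        · rfl
        · rw [star_pairWord_mul_monomial_mul_pairWord_eq_zero (isQFamily_sGen_tGen q n m) hq hij
            hij' hμ hν hα hβ (by tauto) w w' hf]
          simp

/-- Every proper ideal is contained in `𝓜_q`. -/
theorem le_idealM_of_ne_top (hq : ‖q‖ = 1) (hn : 2 ≤ n) (hm : 2 ≤ m) {J : TwoSidedIdeal (E q n m)}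
    (hJ : J ≠ ⊤) : J ≤ idealM q n m := by
  intro x hxJ
  by_contra hx
  have hst := isQFamily_sGen_tGen q n m
  have : Nontrivial (E q n m) :=
    ⟨x, 0, fun h => hx (h ▸ (idealM q n m).zero_mem)⟩
  have hopen : IsOpen ((idealM q n m : Set (E q n m))ᶜ) := (isClosed_closedIdealSpan _).isOpen_compl
  obtain ⟨δ, hδ, hball⟩ := Metric.isOpen_iff.1 hopen x hx
  let R : ∀ k : ℕ, E q n m := fun k =>
    matrixHom (star_pairWord_sGen_mul (q := q) (n := n) (m := m) (k := k)) 1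
  have hRstar (k : ℕ) : star (R k) = R k := by
    rw [← map_star, star_one]
  have hRnorm (k : ℕ) : ‖R k‖ ≤ 1 := norm_matrixHom_one_le _
  -- Otherwise `x * (1 - R k)`, an element of `𝓜_q`, would lie within `δ` of `x`.
  have hxR (k : ℕ) : δ ≤ ‖x * R k‖ := by
    by_contra! h
    have h1 : 1 - R k ∈ idealM q n m := by
      simp only [R, matrixHom_one]
      exact one_sub_sum_pairWord_mem (subset_closedIdealSpan _ (by simp [projQ]))
        (subset_closedIdealSpan _ (by simp [projP])) k
    refine hball (show x * (1 - R k) ∈ Metric.ball x δ from ?_)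
      ((idealM q n m).mul_mem_left _ _ h1)
    rw [Metric.mem_ball, dist_eq_norm, mul_sub, mul_one, sub_sub_cancel_left, norm_neg]
    exact h
  have hRyR (k : ℕ) : δ ^ 2 ≤ ‖R k * (star x * x) * R k‖ := by
    have h1 : R k * (star x * x) * R k = star (x * R k) * (x * R k) := by
      rw [star_mul, hRstar]
      simp only [mul_assoc]
    rw [h1, CStarRing.norm_star_mul_self, ← pow_two]
    exact pow_le_pow_left₀ hδ.le (hxR k) 2
  obtain ⟨r, hr, havg⟩ := exists_norm_le_norm_torusAverage gaugeAt continuous_gaugeAt gaugeAt_one x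
    (ε := δ ^ 2 / 2) (by positivity)
  set y := star x * x with hy
  have hr0 : (0 : ℝ) < r := by exact_mod_cast hr
  -- The averaged compression has norm at least `δ² / (2 r²) = 4η`. Replacing `y` by `p` costs `η`,
  -- and the remaining `3η` still yields a scalar larger than `η`, the final error. Since `r` is
  -- fixed before `K`, the choice of `η` is not circular.
  set η : ℝ := δ ^ 2 / (8 * (r : ℝ) ^ 2) with hη
  have hη0 : 0 < η := by positivity
  obtain ⟨K, p, hp, hyp⟩ := exists_norm_sub_lt_mem_span_boundedMonomials hq y hη0
  -- A multiple of `r`, as the lower bound on averages demands, and larger than `K`, so that the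
  -- average separates degrees.
  set M := r * (K + 1) with hM
  have hKM : K < M := (Nat.lt_succ_self K).trans_le (Nat.le_mul_of_pos_left _ hr)
  have h1 : 4 * η ≤ ‖R K * gaugeAverage M y * R K‖ := by
    have h2 : ‖R K * y * R K‖ - δ ^ 2 / 2 ≤ (r : ℝ) ^ 2 * ‖R K * gaugeAverage M y * R K‖ :=
      havg (K + 1) K.succ_pos (R K) (hRstar K) (hRnorm K)
    have h3 := hRyR K
    have h4 : (r : ℝ) ^ 2 * (4 * η) = δ ^ 2 / 2 := by
      rw [hη]
      field_simp
      norm_num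
    refine le_of_mul_le_mul_left ?_ (pow_pos hr0 2)
    linarith
  have h2 : 3 * η ≤ ‖gaugeAverage M p * R K‖ := by
    have h3 : ‖R K * gaugeAverage M y * R K‖ ≤
        ‖R K * gaugeAverage M (y - p) * R K‖ + ‖R K * gaugeAverage M p * R K‖ := by
      rw [map_sub]
      refine le_trans (le_of_eq ?_) (norm_add_le _ _)
      rw [← add_mul, ← mul_add, sub_add_cancel]
    have h4 : ‖R K * gaugeAverage M (y - p) * R K‖ ≤ 1 * η * 1 := by
      refine norm_mul₃_le.trans ?_
      gcongr
      · exact hRnorm K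
      · exact (norm_torusAverage_le gaugeAt M _).trans hyp.le
      · exact hRnorm K
    have h5 : ‖R K * gaugeAverage M p * R K‖ ≤ 1 * ‖gaugeAverage M p * R K‖ := by
      rw [mul_assoc]
      refine (norm_mul_le _ _).trans ?_
      gcongr
      exact hRnorm K
    linarith
  obtain ⟨C, hC⟩ := exists_gaugeAverage_mul_eq_matrixHom hq hKM hp
  have hC' : gaugeAverage M p * R K = matrixHom star_pairWord_sGen_mul C := hC
  obtain ⟨a, ha, b, hb, hna, hnb, c, hc, habc⟩ :=
    exists_star_mul_matrixHom_mul_eq_smul_one star_pairWord_sGen_mul C hη0.le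
      (by rw [← hC']; linarith)
  have hi : (⟨0, by omega⟩ : Fin n) ≠ ⟨1, by omega⟩ := by simp
  have hi' : (⟨0, by omega⟩ : Fin m) ≠ ⟨1, by omega⟩ := by simp
  obtain ⟨f, hf⟩ : ∃ f, f = word (sGen q n m) (List.replicate K ⟨0, by omega⟩ ++ [⟨1, by omega⟩]) *
    word (tGen q n m) (List.replicate K ⟨0, by omega⟩ ++ [⟨1, by omega⟩]) := ⟨_, rfl⟩
  have hff : star f * f = 1 := by
    rw [hf, star_mul, mul_assoc, ← mul_assoc (star (word (sGen q n m) _)),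
      star_word_mul_word_self hst.star_s_mul_s, one_mul, star_word_mul_word_self hst.star_t_mul_t]
  have hfn : ‖f‖ ≤ 1 := norm_le_one_of_isometry hff
  have hbR : R K * b = b := matrixHom_one_mul _ hb
  -- The factor `f` allows `p` to be replaced by its average, and `b = R K * b` turns that average
  -- into the matrix `C`; finally `f⋆f = 1` removes `f`.
  have hcomp : star (a * f) * p * (b * f) = c • 1 := by
    rw [compression_eq_compression_gaugeAverage hq hi hi' hKM hp hf ha hb]
    calc star (a * f) * gaugeAverage M p * (b * f)
        = star f * (star a * (gaugeAverage M p * R K) * b) * f := by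
          nth_rewrite 1 [← hbR]
          simp only [star_mul, mul_assoc]
      _ = c • 1 := by
          rw [hC', habc, mul_smul_comm, smul_mul_assoc, mul_one, hff]
  have hyJ : star (a * f) * y * (b * f) ∈ J :=
    J.mul_mem_right _ _ (J.mul_mem_left _ _ (J.mul_mem_left _ _ hxJ))
  refine hJ (eq_top_of_norm_sub_smul_one_lt hyJ (c := c) (lt_of_le_of_lt ?_ hc))
  have haf : ‖star (a * f)‖ ≤ 1 := by
    rw [norm_star]
    exact (norm_mul_le _ _).trans (mul_le_one₀ hna (norm_nonneg _) hfn)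
  have hbf : ‖b * f‖ ≤ 1 := (norm_mul_le _ _).trans (mul_le_one₀ hnb (norm_nonneg _) hfn)
  rw [← hcomp, ← sub_mul, ← mul_sub]
  calc ‖star (a * f) * (y - p) * (b * f)‖ ≤ ‖star (a * f)‖ * ‖y - p‖ * ‖b * f‖ := norm_mul₃_le
    _ ≤ 1 * η * 1 := by gcongr
    _ = η := by ring

end Main

end QTensor

end

theorem mainTheorem5 (n m : ℕ) (hn : 2 ≤ n) (hm : 2 ≤ m) (q : ℂ) (hq : ‖q‖ = 1) :
    IsGreatest (QTensor.properIdeals (QTensor.E q n m)) (QTensor.idealM q n m) ∧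
      ∀ J : TwoSidedIdeal (QTensor.E q n m),
        Maximal (· ∈ QTensor.properIdeals (QTensor.E q n m)) J → J = QTensor.idealM q n m := by
  have hM := QTensor.idealM_mem_properIdeals hq (by omega : n ≠ 0) (by omega : m ≠ 0)
  have hle : ∀ J ∈ QTensor.properIdeals (QTensor.E q n m), J ≤ QTensor.idealM q n m :=
    fun J hJ => QTensor.le_idealM_of_ne_top hq hn hm hJ.2
  exact ⟨⟨hM, hle⟩, fun J hJ => le_antisymm (hle J hJ.prop) (hJ.le_of_ge hM (hle J hJ.prop))⟩
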